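/- **Setting.** Let $H_1,\dots,H_L$ be Hermitian operators on $n$ qubits, $H=\sum_{l=1}^L H_l$, $U(x)=e^{-ixH}$, and let $K=1$ or $K=2k$ with $k\ge 1$. Let $S_K$ be the $K$th-order Trotter formula: $S_1(x)=e^{-ixH_L}\cdots e^{-ixH_1}$, $S_2(x)=S_1(-x/2)^\dagger S_1(x/2)$, and for $k\ge 2$ $$S_{2k}(x)=S_{2k-2}(u_kx)^2\,S_{2k-2}((1-4u_k)x)\,S_{2k-2}(u_kx)^2,\qquad u_k=\frac1{4-4^{1/(2k-1)}} .$$ Expanding the recursion writes it as an ordered product of $\kappa$ stages, $$S_K(x)=\prod^{\leftarrow}_{(j,l)}e^{-ix\,a_{(j,l)}H_{\pi_j(l)}},\qquad 1\le j\le\kappa,\ 1\le l\le L,$$ where $\kappa=1$ for $K=1$ and $\kappa=2\cdot5^{k-1}$ for $K=2k$, the pairs $(j,l)$ are ordered lexicographically (larger pairs stand further to the left), $a_{(j,l)}$ is the length of the $j$th stage, and $\pi_j$ is alternately the identity and the reversal of $\{1,\dots,L\}$. Put $V_K(x)=U(x)S_K(x)^\dagger$, $J_K(x)=S_K(x)\big(\tfrac{d}{dx}S_K(x)^\dagger-iH\,S_K(x)^\dagger\big)$,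 and, with $\mathrm{ad}_AB=AB-BA$, $$\begin{aligned}C_s={}&i\sum_{(j,l)}\ \sum_{\sum_{(j',l')\succ(j,l)}m_{(j',l')}=s}\binom{s}{\{m_{(j',l')}\}}\Big(\prod^{\leftarrow}_{(j',l')\succ(j,l)}(-ia_{(j',l')}\mathrm{ad}_{H_{\pi_{j'}(l')}})^{m_{(j',l')}}\Big)(a_{(j,l)}H_{\pi_j(l)})\\&-i\sum_{\sum_{(j',l')}m_{(j',l')}=s}\binom{s}{\{m_{(j',l')}\}}\Big(\prod^{\leftarrow}_{(j',l')}(-ia_{(j',l')}\mathrm{ad}_{H_{\pi_{j'}(l')}})^{m_{(j',l')}}\Big)H ,\end{aligned}$$ $$\tilde V_K(x)=I+\sum_{s=K+1}^{2K+1}C_{s-1}\frac{x^s}{s!}.$$ A $(\mu,\varepsilon)$-LCU formula of an operator $V$ is an operator $\tilde V=\mu\sum_{i}p_iV_i$ (a finite sum) with $\mu>0$, a probability distribution $p$ with positive entries and unitaries $V_i$, such that $\|V-\tilde V\|\le\varepsilon$ in spectral norm. For a norm $\nu$ on operators put $$\alpha^{(s)}_{H,\nu}=\sum_{l=1}^L\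 \sum_{m_1+\dots+m_\Upsilon=s}\binom{s}{m_1,\dots,m_\Upsilon}\,\nu\big(\mathrm{ad}_{A_\Upsilon}^{m_\Upsilon}\cdots\mathrm{ad}_{A_1}^{m_1}H_l\big),$$ where $A_1,\dots,A_\Upsilon$ ($\Upsilon=\kappa L$) is the sequence of the $H_{\pi_j(l)}$ in increasing lexicographical order of $(j,l)$. Write $\alpha_H^{(s)}$ for $\nu$ the spectral norm, and $\alpha_{H,1}^{(s)}$ for $\nu=\|\cdot\|_1$ the $1$-norm. The statement holds for both meanings of the $1$-norm: (i) $\|V\|_1$ is the infimum of $\mu$ over all $(\mu,0)$-LCU formulas of $V$; (ii) $\|V\|_1=\sum_P|c_P|$ for the expansion $V=\sum_Pc_PP$ in Pauli strings. In either case let $\eta_\Sigma=\sum_{s=K+1}^{2K+1}\|C_{s-1}\|_1\frac{x^s}{s!}$. **Proposition.** For every $s\ge0$, $C_s=J_K^{(s)}(0)$. For every $x>0$, $\tilde V_K(x)$ is a $(\mu,\varepsilon)$-LCU formula of $V_K(x)$ with $$\mu=\sqrt{1+\eta_\Sigma^2}\ \le\ \sqrt{1+4\kappa^2\Big(\sum_{s=K}^{2K}\alpha_{H,1}^{(s)}\frac{x^{s+1}}{(s+1)!}\Big)^2},$$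 $$\varepsilon=\|V_K(x)-\tilde V_K(x)\|\ \le\ 4\kappa^2\alpha_H^{(K)}\sum_{s=K}^{2K}\alpha_H^{(s)}\frac{x^{s+K+2}}{s!\,(K+1)!\,(s+K+2)}+2\kappa\frac{x^{2K+2}}{(2K+2)!}\alpha_H^{(2K+1)} .$$ In case (ii), all the unitaries of the formula can be taken to be Pauli rotations $e^{\pm i\arctan(\eta_\Sigma)P}$ with $P$ a Pauli string. Explicitly, if $\eta_\Sigma\neq0$, then $$\tilde V_K(x)=\sqrt{1+\eta_\Sigma^2}\sum_{s=K+1}^{2K+1}\frac{\|C_{s-1}\|_1x^s/s!}{\eta_\Sigma}\sum_{P}\frac{|c_P(C_{s-1})|}{\|C_{s-1}\|_1}\,e^{i\arctan(\eta_\Sigma)\,\sigma_P(C_{s-1})P},$$ where $c_P(C)$ is the coefficient of $P$ in the Pauli expansion of $C$, $\sigma_P(C)=1$ if $\operatorname{Im}c_P(C)\ge0$ and $-1$ otherwise, and terms with $C_{s-1}=0$ are read as $0$. -/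

import Mathlib

open scoped Matrix Matrix.Norms.L2Operator

noncomputable section

namespace TrotterLCU

/-- Operators on `n` qubits, as matrices in the computational basis. The norm `‖V‖` on them is
the spectral norm (the scope `Matrix.Norms.L2Operator` is open). -/
abbrev Op (n : ℕ) : Type := Matrix (Fin n → Fin 2) (Fin n → Fin 2) ℂ

/-! ### Trotter formulas -/

/-- The real-time evolution `exp (-i x H)`. -/
def evolution {n : ℕ} (H : Op n) (x : ℝ) : Op n :=
  NormedSpace.exp ((-(Complex.I * (x : ℂ))) • H)

/-- `exp (-i x H_L) ⋯ exp (-i x H_1)` (the factor of the first summand is rightmost). -/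
def trotterOne {n L : ℕ} (h : Fin L → Op n) (x : ℝ) : Op n :=
  ((List.ofFn fun l => evolution (h l) x).reverse).prod

/-- The Suzuki parameter `u_k = 1 / (4 - 4 ^ (1 / (2k-1)))`, used for `k ≥ 2`. -/
def suzukiParam (k : ℕ) : ℝ := 1 / (4 - (4 : ℝ) ^ (1 / (2 * (k : ℝ) - 1)))

/-- The Suzuki formula `S_{2k}`: `S_0 = I`, `S_2(x) = S_1(-x/2)† S_1(x/2)` and
`S_{2k}(x) = S_{2k-2}(u_k x)^2 S_{2k-2}((1-4u_k) x) S_{2k-2}(u_k x)^2` for `k ≥ 2`. -/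
def suzuki {n L : ℕ} (h : Fin L → Op n) : ℕ → ℝ → Op n
  | 0, _ => 1
  | 1, x => (trotterOne h (-x / 2))ᴴ * trotterOne h (x / 2)
  | k + 2, x =>
      suzuki h (k + 1) (suzukiParam (k + 2) * x) ^ 2 *
        suzuki h (k + 1) ((1 - 4 * suzukiParam (k + 2)) * x) *
        suzuki h (k + 1) (suzukiParam (k + 2) * x) ^ 2

/-- The `K`th-order Trotter formula, meant for `K = 1` or `K` even. -/
def trotter {n L : ℕ} (K : ℕ) (h : Fin L → Op n) (x : ℝ) : Op n :=
  if K = 1 then trotterOne h x else suzuki h (K / 2) x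

/-- The Trotter remainder `V_K(x) = U(x) S_K(x)†`, where `U(x) = exp (-i x ∑ H_l)`. -/
def trotterRemainder {n L : ℕ} (K : ℕ) (h : Fin L → Op n) (x : ℝ) : Op n :=
  evolution (∑ l, h l) x * (trotter K h x)ᴴ

/-- `J_K(x) = S_K(x) (d/dx S_K(x)† - i H S_K(x)†)`. -/
def derivRemainder {n L : ℕ} (K : ℕ) (h : Fin L → Op n) (x : ℝ) : Op n :=
  trotter K h x *
    (deriv (fun y : ℝ => (trotter K h y)ᴴ) x
      - Complex.I • ((∑ l, h l) * (trotter K h x)ᴴ))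

/-! ### The stages of a Trotter formula

A stage is a pair `(a, b)`: its length `a`, and whether the summands are applied in the order
`1, …, L` (`b = true`) or in the reversed order (`b = false`). Stages are listed in the order in
which they are applied, that is, from right to left in the operator product. -/

/-- The stages of `S_{2k}`. -/
def suzukiStages : ℕ → List (ℝ × Bool)
  | 0 => []
  | 1 => [(1 / 2, true), (1 / 2, false)]
  | k + 2 =>
      let c := (suzukiStages (k + 1)).map fun p => (suzukiParam (k + 2) * p.1, p.2)
      let d := (suzukiStages (k + 1)).map fun p => ((1 - 4 * suzukiParam (k + 2)) * p.1, p.2)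
      c ++ c ++ d ++ c ++ c

/-- The stages of the `K`th-order Trotter formula. -/
def trotterStages (K : ℕ) : List (ℝ × Bool) :=
  if K = 1 then [(1, true)] else suzukiStages (K / 2)

/-- The number `κ` of stages: `1` for `K = 1` and `2 * 5 ^ (k - 1)` for `K = 2k`. -/
def stageCount (K : ℕ) : ℕ := if K = 1 then 1 else 2 * 5 ^ (K / 2 - 1)

/-- The `L` steps `(a, l)` of a stage, in the order in which they are applied. -/
def stageSteps (L : ℕ) (p : ℝ × Bool) : List (ℝ × Fin L) :=
  (if p.2 then List.finRange L else (List.finRange L).reverse).map fun l => (p.1, l)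

/-- All the steps `(a_{(j,l)}, π_j(l))` of the `K`th-order Trotter formula, in increasing
lexicographical order of the pairs `(j,l)`. -/
def trotterSteps (K L : ℕ) : List (ℝ × Fin L) :=
  (trotterStages K).flatMap (stageSteps L)

/-- The number `Υ` of pairs `γ = (j,l)`. -/
def stepCount (K L : ℕ) : ℕ := (trotterSteps K L).length

/-- The coefficient `a_γ = a_{(j,l)}`. -/
def stepCoeff (K L : ℕ) (γ : Fin (stepCount K L)) : ℝ := ((trotterSteps K L).get γ).1

/-- The summand `H_γ = H_{π_j(l)}`. -/
def stepOp {n L : ℕ} (K : ℕ) (h : Fin L → Op n) (γ : Fin (stepCount K L)) : Op n :=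
  h ((trotterSteps K L).get γ).2

/-- There are `κ` stages. -/
theorem length_trotterStages {K : ℕ} (hK : K = 1 ∨ (Even K ∧ 0 < K)) :
    (trotterStages K).length = stageCount K := by
  have key : ∀ k : ℕ, (suzukiStages (k + 1)).length = 2 * 5 ^ k := by
    intro k
    induction k with
    | zero => simp [suzukiStages]
    | succ k ih =>
      simp only [suzukiStages, List.length_append, List.length_map, ih]
      ring
  rcases hK with rfl | ⟨⟨m, rfl⟩, hpos⟩
  · simp [trotterStages, stageCount]
  · obtain ⟨k, rfl⟩ : ∃ k, m = k + 1 := ⟨m - 1, by omega⟩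
    have h1 : ¬ (k + 1 + (k + 1) = 1) := by omega
    have h2 : (k + 1 + (k + 1)) / 2 = k + 1 := by omega
    simp [trotterStages, stageCount, h1, h2, key]

/-- There are `κ L` pairs `(j,l)`. -/
theorem stepCount_eq {K : ℕ} (L : ℕ) (hK : K = 1 ∨ (Even K ∧ 0 < K)) :
    stepCount K L = stageCount K * L := by
  have key : ∀ S : List (ℝ × Bool), (S.flatMap (stageSteps L)).length = S.length * L := by
    intro S
    induction S with
    | nil => simp
    | cons p S ih =>
      rw [List.flatMap_cons, List.length_append, ih]
      simp only [stageSteps, List.length_map, List.length_cons]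
      split_ifs <;> simp <;> ring
  rw [stepCount, trotterSteps, key, length_trotterStages hK]

/-- The product of the exponentials of a list of steps, the first step being rightmost. -/
def stepsProd {n L : ℕ} (h : Fin L → Op n) (T : List (ℝ × Fin L)) (x : ℝ) : Op n :=
  ((T.map fun p => evolution (h p.2) (x * p.1)).reverse).prod

theorem stepsProd_append {n L : ℕ} (h : Fin L → Op n) (T T' : List (ℝ × Fin L)) (x : ℝ) :
    stepsProd h (T ++ T') x = stepsProd h T' x * stepsProd h T x := by
  simp [stepsProd]

theorem evolution_conjTranspose {n : ℕ} {H : Op n} (hH : H.IsHermitian) (x : ℝ) :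
    (evolution H x)ᴴ = evolution H (-x) := by
  unfold evolution
  rw [← Matrix.exp_conjTranspose, Matrix.conjTranspose_smul, hH.eq]
  simp

/-- The recursively defined Trotter formula is the ordered product over its steps, the first
step being rightmost. -/
theorem trotter_eq_stepsProd {n L : ℕ} (K : ℕ) (h : Fin L → Op n)
    (hh : ∀ l, (h l).IsHermitian) (x : ℝ) :
    trotter K h x = stepsProd h (trotterSteps K L) x := by
  have scale : ∀ (S : List (ℝ × Bool)) (u y : ℝ),
      stepsProd h ((S.map fun p => (u * p.1, p.2)).flatMap (stageSteps L)) y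
        = stepsProd h (S.flatMap (stageSteps L)) (u * y) := by
    intro S u y
    induction S with
    | nil => simp [stepsProd]
    | cons p S ih =>
      rw [List.map_cons, List.flatMap_cons, List.flatMap_cons, stepsProd_append,
        stepsProd_append, ih]
      congr 1
      simp only [stepsProd, stageSteps, List.map_map, Function.comp_def]
      congr 4
      funext l
      congr 1
      ring
  have one : ∀ (a y : ℝ), stepsProd h (stageSteps L (a, true)) y = trotterOne h (y * a) := by
    intro a y
    simp [stepsProd, stageSteps, trotterOne, List.map_map, Function.comp_def, List.ofFn_eq_map]
  have two : ∀ (a y : ℝ),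
      stepsProd h (stageSteps L (a, false)) y = (trotterOne h (-(y * a)))ᴴ := by
    intro a y
    simp [stepsProd, stageSteps, trotterOne, List.map_map, Function.comp_def, List.ofFn_eq_map,
      Matrix.conjTranspose_list_prod, evolution_conjTranspose (hh _)]
  have main : ∀ k y, suzuki h k y = stepsProd h ((suzukiStages k).flatMap (stageSteps L)) y := by
    intro k
    induction k with
    | zero => intro y; simp [suzuki, suzukiStages, stepsProd]
    | succ k ih =>
      intro y
      cases k with
      | zero =>
        simp only [suzuki, suzukiStages, List.flatMap_cons, List.flatMap_nil, List.append_nil,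
          stepsProd_append, one, two]
        congr 3 <;> ring
      | succ k =>
        simp only [suzuki, suzukiStages, List.flatMap_append, stepsProd_append, scale, ← ih]
        noncomm_ring
  unfold trotter trotterSteps trotterStages
  split_ifs with hK
  · simp [List.flatMap_cons, one]
  · exact main _ _

/-! ### Nested commutators -/

/-- The ordered composition `T_N ^ m_N ∘ ⋯ ∘ T_1 ^ m_1` (the last index is leftmost). -/
def orderedPow {n N : ℕ} (T : Fin N → Module.End ℂ (Op n)) (m : Fin N → ℕ) :
    Module.End ℂ (Op n) :=
  ((List.ofFn fun γ => T γ ^ m γ).reverse).prod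

/-- `ad_A B = A B - B A`. -/
def adj {n : ℕ} (A : Op n) : Module.End ℂ (Op n) :=
  LinearMap.mulLeft ℂ A - LinearMap.mulRight ℂ A

/-- `α_com^{(s)}(A_N, …, A_1; B)
  = ∑_{m_1 + ⋯ + m_N = s} (s choose m_1, …, m_N) ν(ad_{A_N}^{m_N} ⋯ ad_{A_1}^{m_1} B)`
for a matrix norm `ν`. -/
def alphaCom {n N : ℕ} (ν : Op n → ℝ) (s : ℕ) (A : Fin N → Op n) (B : Op n) : ℝ :=
  ∑ m ∈ Finset.piAntidiag (Finset.univ : Finset (Fin N)) s,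
    (Nat.multinomial Finset.univ m : ℝ) * ν (orderedPow (fun γ => adj (A γ)) m B)

/-- The nested commutator norm `α_H^{(s)}` of the `K`th-order Trotter formula with respect to the
matrix norm `ν`. -/
def alphaH {n L : ℕ} (ν : Op n → ℝ) (K : ℕ) (h : Fin L → Op n) (s : ℕ) : ℝ :=
  ∑ l, alphaCom ν s (stepOp K h) (h l)

/-- The coefficient `C_s` in nested-commutator form. In the first sum, `m` ranges over the
exponents that are supported on the `γ' > γ` and sum to `s`. -/
def compCoeff {n L : ℕ} (K : ℕ) (h : Fin L → Op n) (s : ℕ) : Op n :=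
  Complex.I • (∑ γ : Fin (stepCount K L), ∑ m ∈ Finset.piAntidiag (Finset.Ioi γ) s,
      (Nat.multinomial (Finset.Ioi γ) m : ℂ) •
        orderedPow (fun γ' => (-(Complex.I * (stepCoeff K L γ' : ℂ))) • adj (stepOp K h γ')) m
          ((stepCoeff K L γ : ℂ) • stepOp K h γ))
  - Complex.I • (∑ m ∈ Finset.piAntidiag (Finset.univ : Finset (Fin (stepCount K L))) s,
      (Nat.multinomial Finset.univ m : ℂ) •
        orderedPow (fun γ' => (-(Complex.I * (stepCoeff K L γ' : ℂ))) • adj (stepOp K h γ')) m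
          (∑ l, h l))

/-- The nested-commutator compensation `Ṽ_K(x) = I + ∑_{s=K+1}^{2K+1} C_{s-1} x^s / s!`. -/
def compensation {n L : ℕ} (K : ℕ) (h : Fin L → Op n) (x : ℝ) : Op n :=
  1 + ∑ s ∈ Finset.Icc (K + 1) (2 * K + 1),
    ((x ^ s / (s.factorial : ℝ) : ℝ) : ℂ) • compCoeff K h (s - 1)

/-! ### Linear combinations of unitaries -/

/-- `W` is a `(μ, ε)`-LCU formula of `V` whose elementary unitaries belong to the set `E`:
`W = μ ∑_i p_i U_i` with a probability distribution `p` with positive entries and unitaries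
`U_i ∈ E`, and `‖V - W‖ ≤ ε` in spectral norm. -/
def IsLCUFormulaOver {n : ℕ} (E : Set (Op n)) (V W : Op n) (μ ε : ℝ) : Prop :=
  0 < μ ∧ ‖V - W‖ ≤ ε ∧
    ∃ (Γ : ℕ) (p : Fin Γ → ℝ) (U : Fin Γ → Op n),
      (∀ i, 0 < p i) ∧ ∑ i, p i = 1 ∧
      (∀ i, U i ∈ Matrix.unitaryGroup (Fin n → Fin 2) ℂ) ∧ (∀ i, U i ∈ E) ∧
      W = (μ : ℂ) • ∑ i, (p i : ℂ) • U i

/-- `W` is a `(μ, ε)`-LCU formula of `V`, with arbitrary elementary unitaries. -/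
def IsLCUFormula {n : ℕ} (V W : Op n) (μ ε : ℝ) : Prop :=
  IsLCUFormulaOver Set.univ V W μ ε

/-- The `1`-norm of `V`: the infimum of the `μ` over all `(μ, 0)`-LCU formulas of `V`. -/
def oneNorm {n : ℕ} (V : Op n) : ℝ := sInf {μ : ℝ | IsLCUFormula V V μ 0}

/-- `η_Σ = ∑_{s=K+1}^{2K+1} ν(C_{s-1}) x^s / s!` for a matrix norm `ν`. -/
def etaSum {n L : ℕ} (ν : Op n → ℝ) (K : ℕ) (h : Fin L → Op n) (x : ℝ) : ℝ :=
  ∑ s ∈ Finset.Icc (K + 1) (2 * K + 1), ν (compCoeff K h (s - 1)) * (x ^ s / (s.factorial : ℝ))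

/-! ### Pauli operators -/

/-- The matrices `I`, `X`, `Y`, `Z`. -/
def pauli : Fin 4 → Matrix (Fin 2) (Fin 2) ℂ :=
  ![1, !![0, 1; 1, 0], !![0, -Complex.I; Complex.I, 0], !![1, 0; 0, -1]]

/-- The tensor product of the one-qubit Pauli matrices `σ_1, …, σ_n`. -/
def pauliString {n : ℕ} (σ : Fin n → Fin 4) : Op n :=
  Matrix.of fun a b => ∏ i, pauli (σ i) (a i) (b i)

/-- The coefficient of `P_σ` in the Pauli expansion of `V`. -/
def pauliCoeff {n : ℕ} (V : Op n) (σ : Fin n → Fin 4) : ℂ :=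
  (pauliString σ * V).trace / (2 : ℂ) ^ n

/-- The `1`-norm of the Pauli expansion of `V`. -/
def pauliNorm {n : ℕ} (V : Op n) : ℝ := ∑ σ, ‖pauliCoeff V σ‖

/-- The Pauli rotations `exp (i θ P)` and `exp (-i θ P)` of angle `θ`, with `P` a Pauli string. -/
def pauliRotations (n : ℕ) (θ : ℝ) : Set (Op n) :=
  {U | ∃ (σ : Fin n → Fin 4) (ε : ℝ), (ε = 1 ∨ ε = -1) ∧
    U = NormedSpace.exp ((Complex.I * (θ : ℂ)) • ((ε : ℂ) • pauliString σ))}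

/-- For an anti-Hermitian `C = i ‖C‖₁ ∑_σ Pr(σ) P'_σ`, with `P'_σ = ± P_σ` and `‖C‖₁` the Pauli
`1`-norm, the operator `P'_σ`. -/
def signedPauli {n : ℕ} (C : Op n) (σ : Fin n → Fin 4) : Op n :=
  if 0 ≤ (pauliCoeff C σ).im then pauliString σ else -pauliString σ

/-- For an anti-Hermitian `C = i ‖C‖₁ ∑_σ Pr(σ) P'_σ` as above, the mixture
`∑_σ Pr(σ) exp (i arctan(η) P'_σ)` of Pauli rotations. -/
def rotationMixture {n : ℕ} (C : Op n) (η : ℝ) : Op n :=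
  ∑ σ, ((‖pauliCoeff C σ‖ / pauliNorm C : ℝ) : ℂ) •
    NormedSpace.exp ((Complex.I * (Real.arctan η : ℂ)) • signedPauli C σ)

end TrotterLCU

end

open TrotterLCU

open scoped Matrix Matrix.Norms.L2Operator

noncomputable section

namespace TrotterLCU

open scoped ContDiff

/-! The operator `J` is defined so that `V' = V J`. As `S` is an ordered product of exponentials,
`J` is a sum of fixed operators conjugated by some or all of the exponentials of `S`. Conjugation by
`exp (-i x a A)` is an isometric flow with generator `-i a ad_A`. The Leibniz rule for an ordered
product of such flows (`IsFlow.iteratedDeriv_orderedComp`) gives multinomial sums of nested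
commutators as Taylor coefficients of `J`, which are the `C_s`. Since the flows preserve the norm,
the order-`p` remainder is bounded by the sum of the norms of the terms of order `p`
(`IsFlow.norm_orderedComp_sub_taylor_le`).

Two facts about the `C_s` are needed. First, `C_s = 0` for `s < K`, because `S` agrees with `U` to
order `K` (`iteratedDeriv_trotter`). For the Suzuki recursion, the leading discrepancy cancels by
the choice of `u_k`, and time symmetry then gains one further order. Second, `C_s` is
anti-Hermitian, because `V` is unitary.

For the error, write `V' - Ṽ' = (J - T) + (V - 1) J` with `T` the Taylor polynomial of `J` of degree
`2K`. The summands are bounded by nested commutators of order `2K + 1` and by the product of two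
bounds of order `K`, and the sum is integrated. `compNorm_le` turns these bounds into `2κ α`: stage
lengths have modulus at most `1`, and each `H_l` occurs once per stage.

For the LCU formulas, the unit weight of the identity is distributed over the terms of `Ṽ - 1`. In
the Pauli case each term becomes `1 ± i η P`, which is `√(1 + η²)` times a rotation
(`sqrt_smul_exp_arctan`). For arbitrary unitaries, `Ṽ = 1 + X` with `X` anti-Hermitian and `‖X‖ ≤
η`. It is normal with spectrum in the disc of radius `√(1 + η²)`, hence that radius times the mean
of two unitaries (`isLCUFormula_of_diagonal`). -/

/-! ### Multinomial sums and ordered compositions. -/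

open Finset in
/-- A sum over the exponents `m` with `∑ m = s` splits off the exponent at `p`. -/
theorem sum_piAntidiag_univ_succ {M : Type*} [AddCommMonoid M] {N : ℕ} (p : Fin (N + 1)) (s : ℕ)
    (f : (Fin (N + 1) → ℕ) → M) :
    ∑ m ∈ piAntidiag univ s, f m = ∑ q ∈ antidiagonal s, ∑ m ∈ piAntidiag univ q.2,
      f (Fin.insertNth (α := fun _ => ℕ) p q.1 m) := by
  rw [Finset.sum_sigma']
  refine Finset.sum_bij' (fun m _ => ⟨(m p, ∑ i, m (p.succAbove i)), fun i => m (p.succAbove i)⟩)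
    (fun q _ => Fin.insertNth (α := fun _ => ℕ) p q.1.1 q.2) ?_ ?_ ?_ ?_ ?_
  · intro m hm
    have : ∑ i, m i = s := (mem_piAntidiag.1 hm).1
    rw [Fin.sum_univ_succAbove _ p] at this
    simpa using this
  · rintro ⟨⟨i, j⟩, m⟩ hm
    simp only [mem_sigma, HasAntidiagonal.mem_antidiagonal, mem_piAntidiag, mem_univ,
      implies_true, and_true] at hm
    simp only [mem_piAntidiag, mem_univ, implies_true, and_true]
    rw [Fin.sum_univ_succAbove _ p]
    simp [hm.2, hm.1]
  · intro m _
    exact Fin.insertNth_self_removeNth p m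
  · rintro ⟨⟨i, j⟩, m⟩ hm
    simp only [mem_sigma, HasAntidiagonal.mem_antidiagonal, mem_piAntidiag, mem_univ,
      implies_true, and_true] at hm
    obtain ⟨_, rfl⟩ := hm
    simp
  · intro m _
    exact congrArg f (Fin.insertNth_self_removeNth p m).symm

/-- After multiplication by `i! ∏ m_k!` both sides become `(i + ∑ m_k)!`. -/
theorem multinomial_insertNth {N : ℕ} (p : Fin (N + 1)) (i : ℕ) (m : Fin N → ℕ) :
    Nat.multinomial Finset.univ (Fin.insertNth (α := fun _ => ℕ) p i m)
      = (i + ∑ k, m k).choose i * Nat.multinomial Finset.univ m := by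
  have h1 := Nat.multinomial_spec Finset.univ (Fin.insertNth (α := fun _ => ℕ) p i m)
  have h2 := Nat.multinomial_spec Finset.univ m
  rw [Fin.prod_univ_succAbove _ p, Fin.sum_univ_succAbove _ p] at h1
  simp only [Fin.insertNth_apply_same, Fin.insertNth_apply_succAbove] at h1
  have h3 := Nat.add_choose_mul_factorial_mul_factorial i (∑ k, m k)
  rw [← Nat.choose_symm_add] at h3
  have hpos : 0 < i.factorial * ∏ k, (m k).factorial :=
    Nat.mul_pos i.factorial_pos (Finset.prod_pos fun k _ => (m k).factorial_pos)
  refine Nat.eq_of_mul_eq_mul_left hpos ?_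
  rw [h1, ← h3, ← h2]
  ring

open Finset in
/-- The multinomial sums split off the exponent at `p` with a binomial coefficient. -/
theorem sum_multinomial_nsmul_succ {M : Type*} [AddCommMonoid M] {N : ℕ} (p : Fin (N + 1)) (s : ℕ)
    (f : (Fin (N + 1) → ℕ) → M) :
    ∑ m ∈ piAntidiag univ s, Nat.multinomial univ m • f m
      = ∑ q ∈ antidiagonal s, s.choose q.1 • ∑ m ∈ piAntidiag univ q.2,
          Nat.multinomial univ m • f (Fin.insertNth (α := fun _ => ℕ) p q.1 m) := by
  rw [sum_piAntidiag_univ_succ p]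
  refine sum_congr rfl fun q hq => ?_
  rw [smul_sum]
  refine sum_congr rfl fun m hm => ?_
  have h1 : ∑ k, m k = q.2 := (mem_piAntidiag.1 hm).1
  rw [multinomial_insertNth, h1, mem_antidiagonal.1 hq, mul_smul]

/-- The ordered composition `T_N ∘ ⋯ ∘ T_1`. -/
def orderedComp {n N : ℕ} (T : Fin N → Module.End ℂ (Op n)) : Module.End ℂ (Op n) :=
  ((List.ofFn T).reverse).prod

theorem orderedComp_zero {n : ℕ} (T : Fin 0 → Module.End ℂ (Op n)) : orderedComp T = 1 := by
  simp [orderedComp]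

theorem orderedComp_succ {n N : ℕ} (T : Fin (N + 1) → Module.End ℂ (Op n)) :
    orderedComp T = orderedComp (fun i => T i.succ) * T 0 := by
  simp [orderedComp, List.ofFn_succ]

theorem orderedComp_castSucc {n N : ℕ} (T : Fin (N + 1) → Module.End ℂ (Op n)) :
    orderedComp T = T (Fin.last N) * orderedComp (fun i => T i.castSucc) := by
  rw [orderedComp, List.ofFn_succ', List.concat_eq_append, List.reverse_append]
  simp [orderedComp]

theorem orderedPow_insertNth_zero {n N : ℕ} (T : Fin (N + 1) → Module.End ℂ (Op n)) (i : ℕ)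
    (m : Fin N → ℕ) :
    orderedPow T (Fin.insertNth (α := fun _ => ℕ) 0 i m)
      = orderedPow (fun i => T i.succ) m * T 0 ^ i := by
  have := orderedComp_succ fun γ => T γ ^ (Fin.insertNth (α := fun _ => ℕ) 0 i m) γ
  simpa only [orderedPow, orderedComp, Fin.insertNth_zero', Fin.cons_succ, Fin.cons_zero] using this

theorem orderedPow_insertNth_last {n N : ℕ} (T : Fin (N + 1) → Module.End ℂ (Op n)) (i : ℕ)
    (m : Fin N → ℕ) :
    orderedPow T (Fin.insertNth (α := fun _ => ℕ) (Fin.last N) i m)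
      = T (Fin.last N) ^ i * orderedPow (fun i => T i.castSucc) m := by
  have := orderedComp_castSucc fun γ => T γ ^ (Fin.insertNth (α := fun _ => ℕ) (Fin.last N) i m) γ
  simpa [orderedPow, orderedComp] using this

/-- `∑_{|m| = s} (s choose m) T_N ^ m_N ⋯ T_1 ^ m_1 G`. -/
def multiSum {n N : ℕ} (T : Fin N → Module.End ℂ (Op n)) (s : ℕ) (G : Op n) : Op n :=
  ∑ m ∈ Finset.piAntidiag (Finset.univ : Finset (Fin N)) s,
    Nat.multinomial Finset.univ m • orderedPow T m G

/-- `∑_{|m| = s} (s choose m) ν (T_N ^ m_N ⋯ T_1 ^ m_1 G)`. -/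
def multiNorm {n N : ℕ} (ν : Op n → ℝ) (T : Fin N → Module.End ℂ (Op n)) (s : ℕ) (G : Op n) : ℝ :=
  ∑ m ∈ Finset.piAntidiag (Finset.univ : Finset (Fin N)) s,
    Nat.multinomial Finset.univ m • ν (orderedPow T m G)

-- Peeling off the innermost factor suits the Taylor estimate, where the first flow is expanded
-- before the others; `multiSum_castSucc` peels off the outermost one, as the Leibniz rule needs.
open Finset in
theorem multiSum_succ {n N : ℕ} (T : Fin (N + 1) → Module.End ℂ (Op n)) (s : ℕ) (G : Op n) :
    multiSum T s G = ∑ q ∈ antidiagonal s,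
      s.choose q.1 • multiSum (fun i => T i.succ) q.2 ((T 0 ^ q.1) G) := by
  rw [multiSum, sum_multinomial_nsmul_succ 0]
  simp only [orderedPow_insertNth_zero, Module.End.mul_apply]
  rfl

open Finset in
theorem multiNorm_succ {n N : ℕ} (ν : Op n → ℝ) (T : Fin (N + 1) → Module.End ℂ (Op n)) (s : ℕ)
    (G : Op n) :
    multiNorm ν T s G = ∑ q ∈ antidiagonal s,
      s.choose q.1 • multiNorm ν (fun i => T i.succ) q.2 ((T 0 ^ q.1) G) := by
  rw [multiNorm, sum_multinomial_nsmul_succ 0]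
  simp only [orderedPow_insertNth_zero, Module.End.mul_apply]
  rfl

open Finset in
theorem multiSum_castSucc {n N : ℕ} (T : Fin (N + 1) → Module.End ℂ (Op n)) (s : ℕ) (G : Op n) :
    multiSum T s G = ∑ q ∈ antidiagonal s,
      s.choose q.1 • (T (Fin.last N) ^ q.1) (multiSum (fun i => T i.castSucc) q.2 G) := by
  rw [multiSum, sum_multinomial_nsmul_succ (Fin.last N)]
  simp only [orderedPow_insertNth_last, Module.End.mul_apply, multiSum, map_sum, map_nsmul]

/-! ### Isometric flows -/

/-- `Φ` is a smooth family of isometries of the space of operators with `Φ 0 = 1` and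
generator `B`. -/
structure IsFlow {n : ℕ} (Φ : ℝ → Module.End ℂ (Op n)) (B : Module.End ℂ (Op n)) : Prop where
  zero : Φ 0 = 1
  norm_map : ∀ x G, ‖Φ x G‖ = ‖G‖
  hasDerivAt : ∀ (f : ℝ → Op n) (f' : Op n) (x : ℝ), HasDerivAt f f' x →
    HasDerivAt (fun y => Φ y (f y)) (Φ x (B (f x) + f')) x
  contDiff : ∀ f : ℝ → Op n, ContDiff ℝ ∞ f → ContDiff ℝ ∞ fun y => Φ y (f y)

/-- The trivial flow fills the positions `γ' ≤ γ` missing from the `γ`th summand of `J`, so that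
every ordered product runs over the same index set. -/
theorem isFlow_one {n : ℕ} : IsFlow (fun _ => (1 : Module.End ℂ (Op n))) 0 where
  zero := rfl
  norm_map _ _ := rfl
  hasDerivAt f f' x h := by simpa using h
  contDiff f h := h

theorem contDiff_end_apply {n : ℕ} (B : Module.End ℂ (Op n)) {f : ℝ → Op n}
    (h : ContDiff ℝ ∞ f) : ContDiff ℝ ∞ fun y => B (f y) :=
  (LinearMap.toContinuousLinearMap (B.restrictScalars ℝ)).contDiff.comp h

theorem contDiff_deriv {n : ℕ} {f : ℝ → Op n} (h : ContDiff ℝ ∞ f) : ContDiff ℝ ∞ (deriv f) :=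
  (contDiff_infty_iff_deriv.1 h).2

theorem iteratedDeriv_clm_apply {n : ℕ} (B : Op n →L[ℝ] Op n) (s : ℕ) {f : ℝ → Op n}
    (h : ContDiff ℝ ∞ f) (x : ℝ) :
    iteratedDeriv s (fun y => B (f y)) x = B (iteratedDeriv s f x) := by
  induction s generalizing f with
  | zero => simp
  | succ s ih =>
    have h1 : deriv (fun y => B (f y)) = fun y => B (deriv f y) := funext fun y =>
      (B.hasFDerivAt.comp_hasDerivAt y
        (h.differentiable (by simp)).differentiableAt.hasDerivAt).deriv
    rw [iteratedDeriv_succ', iteratedDeriv_succ', h1, ih (contDiff_deriv h)]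

theorem iteratedDeriv_end_apply {n : ℕ} (B : Module.End ℂ (Op n)) (s : ℕ) {f : ℝ → Op n}
    (h : ContDiff ℝ ∞ f) (x : ℝ) :
    iteratedDeriv s (fun y => B (f y)) x = B (iteratedDeriv s f x) :=
  iteratedDeriv_clm_apply (LinearMap.toContinuousLinearMap (B.restrictScalars ℝ)) s h x

-- Differentiation replaces `f` by `B f + f'`. The constant operator `B` commutes with
-- differentiation, so the `s`th derivative is the binomial expansion of `(B + d/dx)^s`; the
-- induction step is Pascal's rule.
open Finset in
theorem IsFlow.iteratedDeriv_zero {n : ℕ} {Φ : ℝ → Module.End ℂ (Op n)} {B : Module.End ℂ (Op n)}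
    (hΦ : IsFlow Φ B) (s : ℕ) {f : ℝ → Op n} (h : ContDiff ℝ ∞ f) :
    iteratedDeriv s (fun y => Φ y (f y)) 0
      = ∑ q ∈ antidiagonal s, s.choose q.1 • (B ^ q.1) (iteratedDeriv q.2 f 0) := by
  induction s generalizing f with
  | zero => simp [hΦ.zero]
  | succ s ih =>
    have h1 : deriv (fun y => Φ y (f y)) = fun y => Φ y ((fun z => B (f z) + deriv f z) y) :=
      funext fun y =>
        (hΦ.hasDerivAt _ _ _ (h.differentiable (by simp)).differentiableAt.hasDerivAt).deriv
    have hB := contDiff_end_apply B h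
    have hd := contDiff_deriv h
    have h2 : ∀ j, iteratedDeriv j (fun z => B (f z) + deriv f z) 0
        = B (iteratedDeriv j f 0) + iteratedDeriv (j + 1) f 0 := by
      intro j
      have := iteratedDeriv_add (n := j) (x := (0 : ℝ))
        (hB.contDiffAt.of_le (by exact_mod_cast le_top))
        (hd.contDiffAt.of_le (by exact_mod_cast le_top))
      rw [iteratedDeriv_end_apply B j h, ← iteratedDeriv_succ'] at this
      exact this
    rw [iteratedDeriv_succ', h1, ih (hB.add hd)]
    rw [sum_antidiagonal_choose_succ_nsmul (fun i j => (B ^ i) (iteratedDeriv j f 0)) s]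
    simp only [h2, map_add, smul_add, sum_add_distrib]
    rw [add_comm]
    congr 1
    refine sum_congr rfl fun q hq => ?_
    rw [pow_succ, Module.End.mul_apply, ← mem_antidiagonal.1 hq, Nat.choose_symm_add]

theorem IsFlow.contDiff_orderedComp {n N : ℕ} {Φ : Fin N → ℝ → Module.End ℂ (Op n)}
    {B : Fin N → Module.End ℂ (Op n)} (hΦ : ∀ i, IsFlow (Φ i) (B i)) (G : Op n) :
    ContDiff ℝ ∞ fun x => orderedComp (fun i => Φ i x) G := by
  induction N with
  | zero => simpa [orderedComp_zero] using contDiff_const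
  | succ N ih =>
    simp only [orderedComp_castSucc, Module.End.mul_apply]
    exact (hΦ _).contDiff _ (ih fun i => hΦ i.castSucc)

/-- The derivatives at `0` of an ordered product of flows. -/
theorem IsFlow.iteratedDeriv_orderedComp {n N : ℕ} {Φ : Fin N → ℝ → Module.End ℂ (Op n)}
    {B : Fin N → Module.End ℂ (Op n)} (hΦ : ∀ i, IsFlow (Φ i) (B i)) (G : Op n) (s : ℕ) :
    iteratedDeriv s (fun x => orderedComp (fun i => Φ i x) G) 0 = multiSum B s G := by
  induction N generalizing s with
  | zero =>
    simp only [orderedComp_zero, Module.End.one_apply, iteratedDeriv_const, multiSum,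
      Finset.univ_eq_empty]
    cases s with
    | zero => simp [orderedPow]
    | succ s => simp
  | succ N ih =>
    simp only [orderedComp_castSucc, Module.End.mul_apply]
    rw [(hΦ _).iteratedDeriv_zero s (contDiff_orderedComp (fun i => hΦ i.castSucc) G),
      multiSum_castSucc]
    simp only [ih fun i => hΦ (Fin.castSucc i)]

theorem IsFlow.norm_orderedComp {n N : ℕ} {Φ : Fin N → ℝ → Module.End ℂ (Op n)}
    {B : Fin N → Module.End ℂ (Op n)} (hΦ : ∀ i, IsFlow (Φ i) (B i)) (x : ℝ) (G : Op n) :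
    ‖orderedComp (fun i => Φ i x) G‖ = ‖G‖ := by
  induction N with
  | zero => simp [orderedComp_zero]
  | succ N ih =>
    rw [orderedComp_castSucc, Module.End.mul_apply, (hΦ _).norm_map]
    exact ih fun i => hΦ i.castSucc

theorem hasDerivAt_pow_div_factorial (p : ℕ) (x : ℝ) :
    HasDerivAt (fun y : ℝ => y ^ (p + 1) / ((p + 1).factorial : ℝ)) (x ^ p / (p.factorial : ℝ)) x := by
  refine ((hasDerivAt_pow (p + 1) x).div_const ((p + 1).factorial : ℝ)).congr_deriv ?_
  have : (p.factorial : ℝ) ≠ 0 := by positivity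
  rw [Nat.factorial_succ]
  push_cast
  field_simp

/-- Taylor's formula for a single flow. -/
theorem IsFlow.norm_sub_taylor_le {n : ℕ} {Φ : ℝ → Module.End ℂ (Op n)} {B : Module.End ℂ (Op n)}
    (hΦ : IsFlow Φ B) (p : ℕ) (G : Op n) {x : ℝ} (hx : 0 ≤ x) :
    ‖Φ x G - ∑ j ∈ Finset.range p, (x ^ j / (j.factorial : ℝ)) • (B ^ j) G‖
      ≤ x ^ p / (p.factorial : ℝ) * ‖(B ^ p) G‖ := by
  induction p generalizing G x with
  | zero => simp [hΦ.norm_map]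
  | succ p ih =>
    set f : ℝ → Op n := fun x =>
      Φ x G - ∑ j ∈ Finset.range (p + 1), (x ^ j / (j.factorial : ℝ)) • (B ^ j) G with hf
    -- The derivative of the remainder of order `p + 1` at `G` is the remainder of order `p` at `B
    -- G`, so the induction hypothesis bounds it and integration gives the next order.
    have hd : ∀ y, HasDerivAt f
        (Φ y (B G) - ∑ j ∈ Finset.range p, (y ^ j / (j.factorial : ℝ)) • (B ^ j) (B G)) y := by
      intro y
      have h1 : HasDerivAt (fun y => Φ y G) (Φ y (B G)) y := by
        simpa using hΦ.hasDerivAt (fun _ => G) 0 y (hasDerivAt_const y G)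
      refine h1.sub ?_
      have h2 : ∀ z : ℝ, ∑ j ∈ Finset.range (p + 1), (z ^ j / (j.factorial : ℝ)) • (B ^ j) G
          = ∑ j ∈ Finset.range p, (z ^ (j + 1) / ((j + 1).factorial : ℝ)) • (B ^ j) (B G) + G := by
        intro z
        rw [Finset.sum_range_succ']
        simp [pow_succ, Module.End.mul_apply]
      simp only [h2]
      refine HasDerivAt.add_const _ ?_
      exact HasDerivAt.fun_sum fun j _ => (hasDerivAt_pow_div_factorial j y).smul_const _
    have h0 : f 0 = 0 := by
      rw [hf]
      simp [Finset.sum_range_succ', hΦ.zero]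
    refine image_norm_le_of_norm_deriv_right_le_deriv_boundary (a := 0) (b := x)
      (B := fun y => y ^ (p + 1) / ((p + 1).factorial : ℝ) * ‖(B ^ (p + 1)) G‖)
      (fun y _ => (hd y).continuousAt.continuousWithinAt) (fun y _ => (hd y).hasDerivWithinAt)
      ?_ (fun y => (hasDerivAt_pow_div_factorial p y).mul_const _) ?_ ⟨hx, le_rfl⟩
    · simp [h0]
    · intro y hy
      have := ih (B G) hy.1
      rwa [← Module.End.mul_apply (B ^ p), ← pow_succ] at this

open Finset in
theorem sum_range_antidiagonal_eq {M : Type*} [AddCommMonoid M] (p : ℕ) (f : ℕ → ℕ → M) :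
    ∑ s ∈ range p, ∑ q ∈ antidiagonal s, f q.1 q.2
      = ∑ j ∈ range p, ∑ k ∈ range (p - j), f j k := by
  rw [sum_sigma', sum_sigma']
  refine sum_bij' (fun q _ => ⟨q.2.1, q.2.2⟩) (fun q _ => ⟨q.1 + q.2, (q.1, q.2)⟩) ?_ ?_ ?_ ?_ ?_
  · rintro ⟨s, i, j⟩ h
    simp only [mem_sigma, mem_range, HasAntidiagonal.mem_antidiagonal] at h ⊢
    omega
  · rintro ⟨i, j⟩ h
    simp only [mem_sigma, mem_range, HasAntidiagonal.mem_antidiagonal, and_true] at h ⊢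
    omega
  · rintro ⟨s, i, j⟩ h
    simp only [mem_sigma, mem_range, HasAntidiagonal.mem_antidiagonal] at h
    obtain ⟨_, rfl⟩ := h
    rfl
  · rintro ⟨i, j⟩ _
    rfl
  · rintro ⟨s, i, j⟩ _
    rfl

theorem pow_div_factorial_mul_choose (x : ℝ) {s i j : ℕ} (h : i + j = s) :
    x ^ s / (s.factorial : ℝ) * (s.choose i : ℝ)
      = x ^ i / (i.factorial : ℝ) * (x ^ j / (j.factorial : ℝ)) := by
  subst h
  have h1 := Nat.add_choose_mul_factorial_mul_factorial i j
  rw [← Nat.choose_symm_add] at h1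
  have h2 : (((i + j).choose i : ℕ) : ℝ) * i.factorial * j.factorial = (i + j).factorial := by
    exact_mod_cast h1
  have h3 : (i.factorial : ℝ) ≠ 0 := by positivity
  have h4 : (j.factorial : ℝ) ≠ 0 := by positivity
  have h5 : ((i + j).factorial : ℝ) ≠ 0 := by positivity
  field_simp
  rw [← h2, pow_add]
  ring

open Finset in
/-- Taylor's formula for an ordered product of flows, with a remainder in nested-commutator
form. -/
theorem IsFlow.norm_orderedComp_sub_taylor_le {n N : ℕ} {Φ : Fin N → ℝ → Module.End ℂ (Op n)}
    {B : Fin N → Module.End ℂ (Op n)} (hΦ : ∀ i, IsFlow (Φ i) (B i)) (p : ℕ) (G : Op n) {x : ℝ}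
    (hx : 0 ≤ x) :
    ‖orderedComp (fun i => Φ i x) G
        - ∑ s ∈ range p, (x ^ s / (s.factorial : ℝ)) • multiSum B s G‖
      ≤ x ^ p / (p.factorial : ℝ) * multiNorm (fun A => ‖A‖) B p G := by
  induction N generalizing p G with
  | zero =>
    simp only [orderedComp_zero, Module.End.one_apply, multiSum, multiNorm, univ_eq_empty]
    cases p with
    | zero => simp [orderedPow]
    | succ p => simp [sum_range_succ', orderedPow]
  | succ N ih =>
    set Ψ : Op n → Op n := fun G => orderedComp (fun i : Fin N => Φ i.succ x) G with hΨ
    set D : ℕ → Op n → Op n := fun s G => multiSum (fun i : Fin N => B i.succ) s G with hD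
    set w : ℕ → ℝ := fun j => x ^ j / (j.factorial : ℝ) with hw
    have hw0 : ∀ j, 0 ≤ w j := fun j => by positivity
    have hsum : ∑ s ∈ range p, w s • multiSum B s G
        = ∑ j ∈ range p, w j • ∑ k ∈ range (p - j), w k • D k ((B 0 ^ j) G) := by
      simp only [smul_sum]
      rw [← sum_range_antidiagonal_eq p fun j k => w j • w k • D k ((B 0 ^ j) G)]
      refine sum_congr rfl fun s _ => ?_
      rw [multiSum_succ, smul_sum]
      refine sum_congr rfl fun q hq => ?_
      rw [← Nat.cast_smul_eq_nsmul ℝ, smul_smul,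
        pow_div_factorial_mul_choose x (mem_antidiagonal.1 hq), mul_smul]
    have hmap : ∀ (c : ℝ) (A : Op n), Ψ (c • A) = c • Ψ A := fun c A => by
      simp only [hΨ]
      exact LinearMap.map_smul_of_tower _ c A
    -- The innermost flow is expanded to order `p`, and its remainder is carried by the isometry
    -- `Ψ`. The term of order `j` is then expanded under `Ψ` only to order `p - j`, so that every
    -- remainder has total order exactly `p`.
    have hsplit : orderedComp (fun i => Φ i x) G - ∑ s ∈ range p, w s • multiSum B s G
        = Ψ (Φ 0 x G - ∑ j ∈ range p, w j • (B 0 ^ j) G)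
          + ∑ j ∈ range p, w j • (Ψ ((B 0 ^ j) G)
              - ∑ k ∈ range (p - j), w k • D k ((B 0 ^ j) G)) := by
      rw [hsum, orderedComp_succ, Module.End.mul_apply]
      have : Ψ (Φ 0 x G - ∑ j ∈ range p, w j • (B 0 ^ j) G)
          = Ψ (Φ 0 x G) - ∑ j ∈ range p, w j • Ψ ((B 0 ^ j) G) := by
        simp only [← hmap]
        simp only [hΨ, map_sub, map_sum]
      rw [this]
      simp only [smul_sub, sum_sub_distrib]
      abel
    -- The order-`p` terms grouped by the exponent `j` of `B 0`: `j = p` matches the remainder of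
    -- the innermost flow, and each `j < p` matches one remainder of order `p - j`.
    have hrhs : w p * multiNorm (fun A => ‖A‖) B p G
        = w p * ‖(B 0 ^ p) G‖ + ∑ j ∈ range p, w j *
          (w (p - j) * multiNorm (fun A => ‖A‖) (fun i : Fin N => B i.succ) (p - j)
            ((B 0 ^ j) G)) := by
      have h0 : ∀ A : Op n, multiNorm (fun A => ‖A‖) (fun i : Fin N => B i.succ) 0 A = ‖A‖ := by
        intro A
        have : orderedPow (fun i : Fin N => B i.succ) 0 = 1 := by simp [orderedPow]
        simp [multiNorm, Nat.multinomial, this]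
      rw [multiNorm_succ, Nat.sum_antidiagonal_eq_sum_range_succ
        (fun i j => p.choose i • multiNorm (fun A => ‖A‖) (fun i : Fin N => B i.succ) j
          ((B 0 ^ i) G)) p, sum_range_succ, mul_add, add_comm, mul_sum]
      congr 1
      · simp [h0]
      · refine sum_congr rfl fun j hj => ?_
        have hj' : j + (p - j) = p := by have := mem_range.1 hj; omega
        rw [nsmul_eq_mul, ← mul_assoc, ← mul_assoc, pow_div_factorial_mul_choose x hj']
    change ‖_ - ∑ s ∈ range p, w s • multiSum B s G‖ ≤ w p * _
    rw [hsplit, hrhs]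
    refine (norm_add_le _ _).trans (add_le_add ?_ ((norm_sum_le _ _).trans (sum_le_sum ?_)))
    · rw [hΨ, norm_orderedComp (fun i => hΦ (Fin.succ i))]
      exact (hΦ 0).norm_sub_taylor_le p G hx
    · intro j _
      rw [norm_smul, Real.norm_of_nonneg (hw0 j)]
      exact mul_le_mul_of_nonneg_left (ih (fun i => hΦ i.succ) (p - j) _) (hw0 j)

/-! ### Evolutions and their conjugation flows -/

theorem evolution_eq_exp_smul {n : ℕ} (A : Op n) (a x : ℝ) :
    evolution A (x * a) = NormedSpace.exp (x • ((-(Complex.I * (a : ℂ))) • A)) := by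
  rw [evolution, ← Complex.coe_smul, smul_smul]
  congr 2
  push_cast
  ring

theorem evolution_zero {n : ℕ} (A : Op n) : evolution A 0 = 1 := by
  simp [evolution]

theorem evolution_mul_neg {n : ℕ} (A : Op n) (x : ℝ) : evolution A x * evolution A (-x) = 1 := by
  rw [evolution, evolution, ← Matrix.exp_add_of_commute]
  · rw [← add_smul]
    simp
  · exact ((Commute.refl A).smul_left _).smul_right _

theorem evolution_mem_unitary {n : ℕ} {A : Op n} (hA : A.IsHermitian) (x : ℝ) :
    evolution A x ∈ unitary (Op n) := by
  rw [Unitary.mem_iff, Matrix.star_eq_conjTranspose, evolution_conjTranspose hA]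
  refine ⟨?_, evolution_mul_neg A x⟩
  simpa using evolution_mul_neg A (-x)

theorem hasDerivAt_evolution {n : ℕ} (A : Op n) (a x : ℝ) :
    HasDerivAt (fun y => evolution A (y * a))
      (evolution A (x * a) * ((-(Complex.I * (a : ℂ))) • A)) x := by
  simp only [evolution_eq_exp_smul]
  exact hasDerivAt_exp_smul_const _ x

theorem hasDerivAt_evolution' {n : ℕ} (A : Op n) (a x : ℝ) :
    HasDerivAt (fun y => evolution A (y * a))
      (((-(Complex.I * (a : ℂ))) • A) * evolution A (x * a)) x := by
  simp only [evolution_eq_exp_smul]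
  exact hasDerivAt_exp_smul_const' _ x

theorem contDiff_evolution {n : ℕ} (A : Op n) (a : ℝ) :
    ContDiff ℝ ∞ fun y => evolution A (y * a) := by
  simp only [evolution_eq_exp_smul]
  have h : AnalyticOnNhd ℝ (NormedSpace.exp : Op n → Op n) Set.univ :=
    fun x _ => NormedSpace.exp_analytic x
  exact (contDiffOn_univ.1 (h.contDiffOn uniqueDiffOn_univ)).comp
    (contDiff_id.smul contDiff_const)

/-- The conjugation `G ↦ exp (-i x a A) G exp (i x a A)`. -/
def conjFlow {n : ℕ} (A : Op n) (a x : ℝ) : Module.End ℂ (Op n) :=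
  LinearMap.mulLeft ℂ (evolution A (x * a)) * LinearMap.mulRight ℂ (evolution A (x * -a))

theorem conjFlow_apply {n : ℕ} (A G : Op n) (a x : ℝ) :
    conjFlow A a x G = evolution A (x * a) * (G * evolution A (x * -a)) := rfl

theorem isFlow_conjFlow {n : ℕ} {A : Op n} (hA : A.IsHermitian) (a : ℝ) :
    IsFlow (conjFlow A a) ((-(Complex.I * (a : ℂ))) • adj A) where
  zero := by
    ext1 G
    simp [conjFlow_apply, evolution_zero]
  norm_map x G := by
    rw [conjFlow_apply, CStarRing.norm_mem_unitary_mul _ (evolution_mem_unitary hA _),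
      CStarRing.norm_mul_mem_unitary _ (evolution_mem_unitary hA _)]
  hasDerivAt f f' x h := by
    simp only [conjFlow_apply]
    -- The generator is written to the right of the left exponential and to the left of the right
    -- one, so that the whole derivative lies between the two.
    refine ((hasDerivAt_evolution A a x).fun_mul
      (h.fun_mul (hasDerivAt_evolution' A (-a) x))).congr_deriv ?_
    have hB : ((-(Complex.I * (a : ℂ))) • adj A) (f x)
        = (-(Complex.I * (a : ℂ))) • (A * f x - f x * A) := rfl
    rw [hB]
    simp only [Complex.ofReal_neg, mul_neg, neg_neg, neg_smul, smul_sub,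
      mul_add, add_mul, smul_mul_assoc, mul_smul_comm, neg_mul, sub_mul, mul_sub, mul_assoc]
    abel
  contDiff f h := by
    simp only [conjFlow_apply]
    exact (contDiff_evolution A a).mul (h.mul (contDiff_evolution A (-a)))

/-! ### Ordered products of exponentials and their logarithmic derivative. -/

/-- The ordered product `exp (-i x a_N A_N) ⋯ exp (-i x a_1 A_1)`. -/
def evolutionProd {n N : ℕ} (A : Fin N → Op n) (a : Fin N → ℝ) (x : ℝ) : Op n :=
  (List.ofFn fun γ => evolution (A γ) (x * a γ)).reverse.prod

theorem evolutionProd_zero {n : ℕ} (A : Fin 0 → Op n) (a : Fin 0 → ℝ) (x : ℝ) :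
    evolutionProd A a x = 1 := by
  simp [evolutionProd]

theorem evolutionProd_castSucc {n N : ℕ} (A : Fin (N + 1) → Op n) (a : Fin (N + 1) → ℝ) (x : ℝ) :
    evolutionProd A a x = evolution (A (Fin.last N)) (x * a (Fin.last N))
      * evolutionProd (fun i => A i.castSucc) (fun i => a i.castSucc) x := by
  rw [evolutionProd, List.ofFn_succ', List.concat_eq_append, List.reverse_append]
  simp [evolutionProd]

theorem evolutionProd_at_zero {n N : ℕ} (A : Fin N → Op n) (a : Fin N → ℝ) :
    evolutionProd A a 0 = 1 := by
  induction N with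
  | zero => exact evolutionProd_zero A a 0
  | succ N ih => simp [evolutionProd_castSucc, ih, evolution_zero]

theorem evolutionProd_mem_unitary {n N : ℕ} {A : Fin N → Op n} (hA : ∀ γ, (A γ).IsHermitian)
    (a : Fin N → ℝ) (x : ℝ) : evolutionProd A a x ∈ unitary (Op n) := by
  induction N with
  | zero => rw [evolutionProd_zero]; exact one_mem _
  | succ N ih =>
    rw [evolutionProd_castSucc]
    exact mul_mem (evolution_mem_unitary (hA _) _) (ih (fun γ => hA γ.castSucc) _)

theorem contDiff_evolutionProd {n N : ℕ} (A : Fin N → Op n) (a : Fin N → ℝ) :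
    ContDiff ℝ ∞ (evolutionProd A a) := by
  induction N with
  | zero => simpa [funext (evolutionProd_zero A a)] using contDiff_const
  | succ N ih =>
    rw [funext (evolutionProd_castSucc A a)]
    exact (contDiff_evolution _ _).mul (ih _ _)

theorem contDiff_conjTranspose {n : ℕ} {f : ℝ → Op n} (h : ContDiff ℝ ∞ f) :
    ContDiff ℝ ∞ fun x => (f x)ᴴ :=
  (starL' ℝ : Op n ≃L[ℝ] Op n).contDiff.comp h

theorem evolutionProd_conj {n N : ℕ} {A : Fin N → Op n} (hA : ∀ γ, (A γ).IsHermitian)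
    (a : Fin N → ℝ) (x : ℝ) (G : Op n) :
    evolutionProd A a x * G * (evolutionProd A a x)ᴴ
      = orderedComp (fun γ => conjFlow (A γ) (a γ) x) G := by
  induction N with
  | zero => simp [evolutionProd_zero, orderedComp_zero]
  | succ N ih =>
    rw [evolutionProd_castSucc, orderedComp_castSucc, Module.End.mul_apply,
      ← ih fun γ => hA γ.castSucc, conjFlow_apply, Matrix.conjTranspose_mul,
      evolution_conjTranspose (hA _)]
    simp only [mul_assoc, mul_neg]

/-- `S (d/dx S†) = i ∑_γ (∏_{γ' > γ} exp (-i x a_γ' ad A_γ')) (a_γ A_γ)` for the ordered product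
`S` of the `exp (-i x a_γ A_γ)`. -/
def logDeriv {n N : ℕ} (A : Fin N → Op n) (a : Fin N → ℝ) (x : ℝ) : Op n :=
  Complex.I • ∑ γ, orderedComp (fun γ' => if γ < γ' then conjFlow (A γ') (a γ') x else 1)
    ((a γ : ℂ) • A γ)

/-- A new outermost exponential conjugates all earlier contributions, while its own is conjugated by
nothing. -/
theorem logDeriv_castSucc {n N : ℕ} (A : Fin (N + 1) → Op n) (a : Fin (N + 1) → ℝ) (x : ℝ) :
    logDeriv A a x = conjFlow (A (Fin.last N)) (a (Fin.last N)) x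
        (logDeriv (fun i => A i.castSucc) (fun i => a i.castSucc) x)
      + (Complex.I * (a (Fin.last N) : ℂ)) • A (Fin.last N) := by
  have h1 : ∀ M, orderedComp (fun _ : Fin M => (1 : Module.End ℂ (Op n))) = 1 := by
    intro M
    simp [orderedComp]
  rw [logDeriv, Fin.sum_univ_castSucc, smul_add, logDeriv,
    map_smul (conjFlow (A (Fin.last N)) (a (Fin.last N)) x), map_sum]
  congr 1
  · congr 1
    refine Finset.sum_congr rfl fun γ _ => ?_
    rw [orderedComp_castSucc, Module.End.mul_apply, if_pos (Fin.castSucc_lt_last γ)]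
    rfl
  · have h2 : (fun γ' => if Fin.last N < γ' then conjFlow (A γ') (a γ') x else 1)
        = fun _ => (1 : Module.End ℂ (Op n)) :=
      funext fun γ' => if_neg (not_lt.2 (Fin.le_last γ'))
    rw [h2, h1, Module.End.one_apply, smul_smul]

/-- The product rule for the adjoint of the product reproduces the recursion `logDeriv_castSucc`
once the outermost exponential times its inverse is inserted. -/
theorem hasDerivAt_evolutionProd_conjTranspose {n N : ℕ} {A : Fin N → Op n}
    (hA : ∀ γ, (A γ).IsHermitian) (a : Fin N → ℝ) (x : ℝ) :
    HasDerivAt (fun y => (evolutionProd A a y)ᴴ) ((evolutionProd A a x)ᴴ * logDeriv A a x) x := by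
  induction N with
  | zero => simpa [evolutionProd_zero, logDeriv] using hasDerivAt_const x (1 : Op n)
  | succ N ih =>
    simp only [evolutionProd_castSucc, Matrix.conjTranspose_mul, evolution_conjTranspose (hA _),
      ← mul_neg]
    refine ((ih (fun γ => hA γ.castSucc) _).mul
      (hasDerivAt_evolution' (A (Fin.last N)) (-a (Fin.last N)) x)).congr_deriv ?_
    have h1 : evolution (A (Fin.last N)) (x * -a (Fin.last N))
        * evolution (A (Fin.last N)) (x * a (Fin.last N)) = 1 := by
      simpa using evolution_mul_neg (A (Fin.last N)) (x * -a (Fin.last N))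
    have h2 : Commute (evolution (A (Fin.last N)) (x * -a (Fin.last N))) (A (Fin.last N)) :=
      Commute.exp_left (𝔸 := Op n) ((Commute.refl (A (Fin.last N))).smul_left _)
    rw [logDeriv_castSucc, conjFlow_apply, mul_add]
    congr 1
    · rw [mul_assoc, mul_assoc, ← mul_assoc (evolution _ (x * -_)) (evolution _ _), h1, one_mul]
    · rw [mul_assoc]
      congr 1
      rw [mul_neg] at h2
      simp [h2.eq]

theorem trotter_eq_evolutionProd {n L : ℕ} (K : ℕ) {h : Fin L → Op n}
    (hh : ∀ l, (h l).IsHermitian) (x : ℝ) :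
    trotter K h x = evolutionProd (stepOp K h) (stepCoeff K L) x := by
  rw [trotter_eq_stepsProd K h hh, stepsProd, evolutionProd]
  congr 2
  rw [← List.ofFn_get (List.map _ _)]
  refine List.ext_get (by simp [stepCount]) ?_
  intro i h1 h2
  simp [stepOp, stepCoeff]
  rfl

theorem derivRemainder_eq {n L : ℕ} (K : ℕ) {h : Fin L → Op n}
    (hh : ∀ l, (h l).IsHermitian) (x : ℝ) :
    derivRemainder K h x = logDeriv (stepOp K h) (stepCoeff K L) x
      - Complex.I • orderedComp (fun γ => conjFlow (stepOp K h γ) (stepCoeff K L γ) x)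
          (∑ l, h l) := by
  have hA : ∀ γ, (stepOp K h γ).IsHermitian := fun γ => hh _
  have h1 := (Unitary.mem_iff.1 (evolutionProd_mem_unitary hA (stepCoeff K L) x)).2
  rw [Matrix.star_eq_conjTranspose] at h1
  have h2 : (fun y => (trotter K h y)ᴴ)
      = fun y => (evolutionProd (stepOp K h) (stepCoeff K L) y)ᴴ :=
    funext fun y => by rw [trotter_eq_evolutionProd K hh]
  rw [derivRemainder, h2, (hasDerivAt_evolutionProd_conjTranspose hA _ x).deriv,
    trotter_eq_evolutionProd K hh, ← evolutionProd_conj hA, mul_sub, ← mul_assoc, h1, one_mul,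
    mul_smul_comm, mul_assoc]

/-! ### The coefficients `C_s` -/

/-- The generators `-i a_γ ad_{H_γ}` restricted to the `γ` with `P γ`, the others being `0`. -/
def stepGen {n L : ℕ} (K : ℕ) (h : Fin L → Op n) (P : Fin (stepCount K L) → Prop) [DecidablePred P]
    (γ : Fin (stepCount K L)) : Module.End ℂ (Op n) :=
  (if P γ then -(Complex.I * (stepCoeff K L γ : ℂ)) else 0) • adj (stepOp K h γ)

/-- The flows generated by `stepGen`. -/
def stepFlow {n L : ℕ} (K : ℕ) (h : Fin L → Op n) (P : Fin (stepCount K L) → Prop)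
    [DecidablePred P] (γ : Fin (stepCount K L)) (x : ℝ) : Module.End ℂ (Op n) :=
  if P γ then conjFlow (stepOp K h γ) (stepCoeff K L γ) x else 1

theorem isFlow_stepFlow {n L : ℕ} (K : ℕ) {h : Fin L → Op n} (hh : ∀ l, (h l).IsHermitian)
    (P : Fin (stepCount K L) → Prop) [DecidablePred P] (γ : Fin (stepCount K L)) :
    IsFlow (stepFlow K h P γ) (stepGen K h P γ) := by
  unfold stepFlow stepGen
  split_ifs
  · exact isFlow_conjFlow (hh _) _
  · rw [zero_smul]
    exact isFlow_one

theorem orderedPow_eq_zero {n N : ℕ} {T : Fin N → Module.End ℂ (Op n)} {m : Fin N → ℕ} {γ : Fin N}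
    (hT : T γ = 0) (hm : m γ ≠ 0) : orderedPow T m = 0 := by
  refine List.prod_eq_zero (List.mem_reverse.2 ((List.mem_ofFn' _ _).2 ⟨γ, ?_⟩))
  simp [hT, hm]

/-- The zero generators kill every multi-index with a nonzero exponent outside `Ioi γ`. Zero
exponents do not affect the multinomial coefficient of the others. -/
theorem multiSum_stepGen_lt {n L : ℕ} (K : ℕ) (h : Fin L → Op n) (γ : Fin (stepCount K L)) (s : ℕ)
    (G : Op n) :
    multiSum (stepGen K h (γ < ·)) s G = ∑ m ∈ Finset.piAntidiag (Finset.Ioi γ) s,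
      (Nat.multinomial (Finset.Ioi γ) m : ℂ) •
        orderedPow (fun γ' => (-(Complex.I * (stepCoeff K L γ' : ℂ))) • adj (stepOp K h γ')) m G := by
  symm
  have hsub : Finset.piAntidiag (Finset.Ioi γ) s ⊆ Finset.piAntidiag Finset.univ s := by
    intro m hm
    rw [Finset.mem_piAntidiag] at hm ⊢
    refine ⟨?_, fun i _ => Finset.mem_univ i⟩
    rw [← hm.1]
    refine (Finset.sum_subset (Finset.subset_univ _) fun i _ hi => ?_).symm
    by_contra h0
    exact hi (hm.2 i h0)
  rw [multiSum, ← Finset.sum_subset hsub]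
  · refine Finset.sum_congr rfl fun m hm => ?_
    rw [Finset.mem_piAntidiag] at hm
    have h0 : ∀ i, i ∉ Finset.Ioi γ → m i = 0 := fun i hi => by
      by_contra h0
      exact hi (hm.2 i h0)
    have h1 : Nat.multinomial Finset.univ m = Nat.multinomial (Finset.Ioi γ) m := by
      rw [Nat.multinomial, Nat.multinomial,
        Finset.sum_subset (Finset.subset_univ (Finset.Ioi γ)) fun i _ hi => h0 i hi,
        Finset.prod_subset (Finset.subset_univ (Finset.Ioi γ)) fun i _ hi => by simp [h0 i hi]]
    rw [Nat.cast_smul_eq_nsmul, h1, orderedPow, orderedPow]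
    congr 6
    funext i
    -- Outside `Ioi γ` the generators differ, but the exponent is `0` and both powers are `1`.
    by_cases hi : γ < i
    · simp [stepGen, hi]
    · simp [h0 i (by simpa using hi)]
  · intro m hm hm'
    have : ∃ i, m i ≠ 0 ∧ i ∉ Finset.Ioi γ := by
      by_contra! hcon
      refine hm' (Finset.mem_piAntidiag.2 ⟨?_, hcon⟩)
      rw [← (Finset.mem_piAntidiag.1 hm).1]
      refine Finset.sum_subset (Finset.subset_univ _) fun i _ hi => ?_
      by_contra h0
      exact hi (hcon i h0)
    obtain ⟨i, hi0, hi⟩ := this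
    have hz : stepGen K h (γ < ·) i = 0 := by
      simp only [Finset.mem_Ioi] at hi
      simp [stepGen, hi]
    rw [orderedPow_eq_zero hz hi0, LinearMap.zero_apply, smul_zero]

theorem compCoeff_eq {n L : ℕ} (K : ℕ) (h : Fin L → Op n) (s : ℕ) :
    compCoeff K h s = Complex.I • (∑ γ : Fin (stepCount K L),
        multiSum (stepGen K h (γ < ·)) s ((stepCoeff K L γ : ℂ) • stepOp K h γ))
      - Complex.I • multiSum (stepGen K h fun _ => True) s (∑ l, h l) := by
  rw [compCoeff]
  congr 2
  · exact Finset.sum_congr rfl fun γ _ => (multiSum_stepGen_lt K h γ s _).symm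
  · have : stepGen K h (fun _ => True)
        = fun γ => (-(Complex.I * (stepCoeff K L γ : ℂ))) • adj (stepOp K h γ) :=
      funext fun γ => by simp [stepGen]
    simp only [multiSum, Nat.cast_smul_eq_nsmul, this]

theorem derivRemainder_eq_stepFlow {n L : ℕ} (K : ℕ) {h : Fin L → Op n}
    (hh : ∀ l, (h l).IsHermitian) (x : ℝ) :
    derivRemainder K h x = Complex.I • (∑ γ : Fin (stepCount K L),
        orderedComp (fun γ' => stepFlow K h (γ < ·) γ' x) ((stepCoeff K L γ : ℂ) • stepOp K h γ))
      - Complex.I • orderedComp (fun γ' => stepFlow K h (fun _ => True) γ' x) (∑ l, h l) := by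
  rw [derivRemainder_eq K hh, logDeriv]
  simp only [stepFlow, if_true]

theorem contDiff_derivRemainder {n L : ℕ} (K : ℕ) {h : Fin L → Op n}
    (hh : ∀ l, (h l).IsHermitian) : ContDiff ℝ ∞ (derivRemainder K h) := by
  rw [funext (derivRemainder_eq_stepFlow K hh)]
  refine ContDiff.sub ?_ ?_
  · have hs : ContDiff ℝ ∞ fun x => ∑ γ : Fin (stepCount K L), orderedComp
        (fun γ' => stepFlow K h (γ < ·) γ' x) ((stepCoeff K L γ : ℂ) • stepOp K h γ) :=
      ContDiff.sum fun γ _ => IsFlow.contDiff_orderedComp (isFlow_stepFlow K hh _) _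
    exact contDiff_end_apply (Complex.I • 1) hs
  · exact contDiff_end_apply (Complex.I • 1) (IsFlow.contDiff_orderedComp (isFlow_stepFlow K hh _) _)

/-- The `C_s` are the Taylor coefficients of `J_K`. -/
theorem compCoeff_eq_iteratedDeriv {n L : ℕ} (K : ℕ) {h : Fin L → Op n}
    (hh : ∀ l, (h l).IsHermitian) (s : ℕ) :
    compCoeff K h s = iteratedDeriv s (derivRemainder K h) 0 := by
  have hle : ((s : ℕ∞) : WithTop ℕ∞) ≤ ∞ := by exact_mod_cast le_top
  have hc1 : ∀ γ : Fin (stepCount K L), ContDiff ℝ ∞ fun x =>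
      orderedComp (fun γ' => stepFlow K h (γ < ·) γ' x) ((stepCoeff K L γ : ℂ) • stepOp K h γ) :=
    fun γ => IsFlow.contDiff_orderedComp (isFlow_stepFlow K hh _) _
  have hc2 : ContDiff ℝ ∞ fun x =>
      orderedComp (fun γ' => stepFlow K h (fun _ => True) γ' x) (∑ l, h l) :=
    IsFlow.contDiff_orderedComp (isFlow_stepFlow K hh _) _
  have hs : ContDiff ℝ ∞ fun x => ∑ γ : Fin (stepCount K L),
      orderedComp (fun γ' => stepFlow K h (γ < ·) γ' x) ((stepCoeff K L γ : ℂ) • stepOp K h γ) :=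
    ContDiff.sum fun γ _ => hc1 γ
  rw [funext (derivRemainder_eq_stepFlow K hh)]
  have h1 := iteratedDeriv_sub (n := s) (x := (0 : ℝ))
    ((contDiff_end_apply (Complex.I • 1) hs).contDiffAt.of_le hle)
    ((contDiff_end_apply (Complex.I • 1) hc2).contDiffAt.of_le hle)
  refine Eq.trans ?_ h1.symm
  rw [compCoeff_eq]
  congr 1
  · have h2 := iteratedDeriv_end_apply (Complex.I • 1) s hs 0
    refine Eq.trans ?_ h2.symm
    rw [LinearMap.smul_apply, Module.End.one_apply]
    rw [iteratedDeriv_fun_sum fun γ _ => ((hc1 γ).contDiffAt.of_le hle)]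
    simp only [IsFlow.iteratedDeriv_orderedComp (isFlow_stepFlow K hh _)]
  · have h2 := iteratedDeriv_end_apply (Complex.I • 1) s hc2 0
    refine Eq.trans ?_ h2.symm
    rw [LinearMap.smul_apply, Module.End.one_apply]
    rw [IsFlow.iteratedDeriv_orderedComp (isFlow_stepFlow K hh _)]

/-! ### Bounds in terms of nested commutators -/

/-- The sum of the norms of all the terms of `C_s`. -/
def compNorm {n L : ℕ} (ν : Op n → ℝ) (K : ℕ) (h : Fin L → Op n) (s : ℕ) : ℝ :=
  (∑ γ : Fin (stepCount K L),
    multiNorm ν (stepGen K h (γ < ·)) s ((stepCoeff K L γ : ℂ) • stepOp K h γ))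
    + multiNorm ν (stepGen K h fun _ => True) s (∑ l, h l)

theorem seminorm_sum_le {n : ℕ} (ν : Seminorm ℂ (Op n)) {ι : Type*} (t : Finset ι) (f : ι → Op n) :
    ν (∑ i ∈ t, f i) ≤ ∑ i ∈ t, ν (f i) :=
  Finset.le_sum_of_subadditive ν (map_zero ν).le (map_add_le_add ν) t f

theorem seminorm_multiSum_le {n N : ℕ} (ν : Seminorm ℂ (Op n)) (T : Fin N → Module.End ℂ (Op n))
    (s : ℕ) (G : Op n) : ν (multiSum T s G) ≤ multiNorm ν T s G := by
  refine (seminorm_sum_le ν _ _).trans_eq (Finset.sum_congr rfl fun m _ => ?_)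
  rw [← Nat.cast_smul_eq_nsmul ℂ, map_smul_eq_mul, Complex.norm_natCast, nsmul_eq_mul]

/-- A general seminorm serves both the spectral norm and the Pauli norm. The infimum norm `oneNorm`
is treated later by comparison with the spectral norm. -/
theorem seminorm_compCoeff_le {n L : ℕ} (ν : Seminorm ℂ (Op n)) (K : ℕ) (h : Fin L → Op n)
    (s : ℕ) : ν (compCoeff K h s) ≤ compNorm ν K h s := by
  rw [compCoeff_eq, compNorm]
  refine (map_sub_le_add ν _ _).trans (add_le_add ?_ ?_)
  · rw [map_smul_eq_mul, Complex.norm_I, one_mul]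
    exact (seminorm_sum_le ν _ _).trans
      (Finset.sum_le_sum fun γ _ => seminorm_multiSum_le ν _ _ _)
  · rw [map_smul_eq_mul, Complex.norm_I, one_mul]
    exact seminorm_multiSum_le ν _ _ _

/-- Taylor's formula for `J_K` with a remainder in nested-commutator form. -/
theorem norm_derivRemainder_sub_taylor_le {n L : ℕ} (K : ℕ) {h : Fin L → Op n}
    (hh : ∀ l, (h l).IsHermitian) (p : ℕ) {x : ℝ} (hx : 0 ≤ x) :
    ‖derivRemainder K h x
        - ∑ s ∈ Finset.range p, (x ^ s / (s.factorial : ℝ)) • compCoeff K h s‖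
      ≤ x ^ p / (p.factorial : ℝ) * compNorm (fun A => ‖A‖) K h p := by
  set w : ℕ → ℝ := fun s => x ^ s / (s.factorial : ℝ) with hw
  have hsplit : derivRemainder K h x - ∑ s ∈ Finset.range p, w s • compCoeff K h s
      = Complex.I • (∑ γ : Fin (stepCount K L),
          (orderedComp (fun γ' => stepFlow K h (γ < ·) γ' x)
              ((stepCoeff K L γ : ℂ) • stepOp K h γ)
            - ∑ s ∈ Finset.range p, w s • multiSum (stepGen K h (γ < ·)) s
              ((stepCoeff K L γ : ℂ) • stepOp K h γ)))
        - Complex.I • (orderedComp (fun γ' => stepFlow K h (fun _ => True) γ' x) (∑ l, h l)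
            - ∑ s ∈ Finset.range p, w s • multiSum (stepGen K h fun _ => True) s (∑ l, h l)) := by
    rw [derivRemainder_eq_stepFlow K hh]
    simp only [compCoeff_eq, smul_sub, Finset.sum_sub_distrib, Finset.smul_sum]
    rw [Finset.sum_comm]
    simp only [smul_comm Complex.I]
    abel
  change ‖_ - ∑ s ∈ Finset.range p, w s • compCoeff K h s‖ ≤ _
  rw [hsplit, compNorm, mul_add, Finset.mul_sum]
  refine (norm_sub_le _ _).trans (add_le_add ?_ ?_)
  · rw [norm_smul, Complex.norm_I, one_mul]
    refine (norm_sum_le _ _).trans (Finset.sum_le_sum fun γ _ => ?_)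
    exact IsFlow.norm_orderedComp_sub_taylor_le (isFlow_stepFlow K hh _) p _ hx
  · rw [norm_smul, Complex.norm_I, one_mul]
    exact IsFlow.norm_orderedComp_sub_taylor_le (isFlow_stepFlow K hh _) p _ hx

theorem orderedComp_smul {n N : ℕ} (c : Fin N → ℂ) (T : Fin N → Module.End ℂ (Op n)) :
    orderedComp (fun γ => c γ • T γ) = (∏ γ, c γ) • orderedComp T := by
  induction N with
  | zero => simp [orderedComp_zero]
  | succ N ih =>
    rw [orderedComp_succ, orderedComp_succ, ih, Fin.prod_univ_succ, smul_mul_smul_comm, mul_comm]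

theorem orderedPow_smul {n N : ℕ} (c : Fin N → ℂ) (T : Fin N → Module.End ℂ (Op n))
    (m : Fin N → ℕ) :
    orderedPow (fun γ => c γ • T γ) m = (∏ γ, c γ ^ m γ) • orderedPow T m := by
  have := orderedComp_smul (fun γ => c γ ^ m γ) (fun γ => T γ ^ m γ)
  simp only [← smul_pow] at this
  exact this

theorem multiNorm_smul_le {n N : ℕ} (ν : Seminorm ℂ (Op n)) {c : Fin N → ℂ} (hc : ∀ γ, ‖c γ‖ ≤ 1)
    (T : Fin N → Module.End ℂ (Op n)) (s : ℕ) (G : Op n) :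
    multiNorm ν (fun γ => c γ • T γ) s G ≤ multiNorm ν T s G := by
  refine Finset.sum_le_sum fun m _ => nsmul_le_nsmul_right ?_ _
  rw [orderedPow_smul, LinearMap.smul_apply, map_smul_eq_mul]
  refine mul_le_of_le_one_left (apply_nonneg ν _) ?_
  rw [norm_prod]
  refine Finset.prod_le_one (fun γ _ => norm_nonneg _) fun γ _ => ?_
  rw [norm_pow]
  exact pow_le_one₀ (norm_nonneg _) (hc γ)

theorem multiNorm_arg_smul_le {n N : ℕ} (ν : Seminorm ℂ (Op n)) {c : ℂ} (hc : ‖c‖ ≤ 1)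
    (T : Fin N → Module.End ℂ (Op n)) (s : ℕ) (G : Op n) :
    multiNorm ν T s (c • G) ≤ multiNorm ν T s G := by
  refine Finset.sum_le_sum fun m _ => nsmul_le_nsmul_right ?_ _
  rw [map_smul, map_smul_eq_mul]
  exact mul_le_of_le_one_left (apply_nonneg ν _) hc

theorem multiNorm_sum_le {n N L : ℕ} (ν : Seminorm ℂ (Op n)) (T : Fin N → Module.End ℂ (Op n))
    (s : ℕ) (h : Fin L → Op n) :
    multiNorm ν T s (∑ l, h l) ≤ ∑ l, multiNorm ν T s (h l) := by
  simp only [multiNorm]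
  rw [Finset.sum_comm]
  refine Finset.sum_le_sum fun m _ => ?_
  rw [← Finset.smul_sum, map_sum]
  exact nsmul_le_nsmul_right (seminorm_sum_le ν _ _) _

theorem alphaCom_eq_multiNorm {n N : ℕ} (ν : Op n → ℝ) (s : ℕ) (A : Fin N → Op n) (B : Op n) :
    alphaCom ν s A B = multiNorm ν (fun γ => adj (A γ)) s B := by
  simp only [alphaCom, multiNorm, nsmul_eq_mul]

/-- With `t = 4 ^ (1/(2k-1))`, which lies in `(1, 2)` since `k ≥ 2`, one has `u = 1/(4 - t) ≤ 1/2`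
and `1 - 4u = -t u`. The exponent is odd and `t ^ (2k-1) = 4`, so the two terms cancel. -/
theorem suzukiParam_mem {k : ℕ} (hk : 2 ≤ k) :
    |suzukiParam k| ≤ 1 ∧ |1 - 4 * suzukiParam k| ≤ 1 ∧
      4 * suzukiParam k ^ (2 * k - 1) + (1 - 4 * suzukiParam k) ^ (2 * k - 1) = 0 := by
  have hk' : (2 : ℝ) ≤ k := by exact_mod_cast hk
  set t : ℝ := (4 : ℝ) ^ (1 / (2 * (k : ℝ) - 1)) with ht
  have hpos : 0 < 2 * (k : ℝ) - 1 := by linarith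
  have h1 : 1 < t := Real.one_lt_rpow (by norm_num) (by positivity)
  have h2 : t < 2 := by
    have h4 : (4 : ℝ) ^ (1 / 2 : ℝ) = 2 := by
      rw [← Real.sqrt_eq_rpow, show (4 : ℝ) = 2 ^ 2 by norm_num, Real.sqrt_sq (by norm_num)]
    rw [← h4]
    refine Real.rpow_lt_rpow_of_exponent_lt (by norm_num) ?_
    exact one_div_lt_one_div_of_lt (by norm_num) (by linarith)
  have hu : suzukiParam k = 1 / (4 - t) := rfl
  have h3 : 0 < 4 - t := by linarith
  have hu4 : 1 - 4 * suzukiParam k = -(t * suzukiParam k) := by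
    rw [hu]
    field_simp
    ring
  have hu0 : 0 < suzukiParam k := by rw [hu]; positivity
  have hu1 : suzukiParam k ≤ 1 / 2 := by
    rw [hu]
    exact one_div_le_one_div_of_le (by norm_num) (by linarith)
  refine ⟨by rw [abs_of_pos hu0]; linarith, ?_, ?_⟩
  · rw [hu4, abs_neg, abs_of_pos (by positivity)]
    nlinarith
  · have hodd : Odd (2 * k - 1) := ⟨k - 1, by omega⟩
    have ht4 : t ^ (2 * k - 1) = 4 := by
      rw [ht, ← Real.rpow_natCast, ← Real.rpow_mul (by norm_num)]
      have : ((2 * k - 1 : ℕ) : ℝ) = 2 * (k : ℝ) - 1 := by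
        rw [Nat.cast_sub (by omega)]
        push_cast
        ring
      rw [this, one_div_mul_cancel hpos.ne', Real.rpow_one]
    rw [hu4, hodd.neg_pow, mul_pow, ht4]
    ring

theorem abs_trotterStages_le {K : ℕ} {p : ℝ × Bool} (hp : p ∈ trotterStages K) : |p.1| ≤ 1 := by
  have key : ∀ k, ∀ p ∈ suzukiStages k, |p.1| ≤ 1 := by
    intro k
    induction k with
    | zero => simp [suzukiStages]
    | succ k ih =>
      cases k with
      | zero =>
        intro p hp
        simp only [suzukiStages, List.mem_cons, List.not_mem_nil, or_false] at hp
        rcases hp with rfl | rfl <;> norm_num [abs_of_pos]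
      | succ k =>
        obtain ⟨h1, h2, _⟩ := suzukiParam_mem (k := k + 2) (by omega)
        have hm : ∀ u : ℝ, |u| ≤ 1 → ∀ p ∈ (suzukiStages (k + 1)).map fun p => (u * p.1, p.2),
            |p.1| ≤ 1 := by
          intro u hu p hp
          obtain ⟨q, hq, rfl⟩ := List.mem_map.1 hp
          rw [abs_mul]
          exact mul_le_one₀ hu (abs_nonneg _) (ih q hq)
        intro p hp
        simp only [suzukiStages, List.mem_append] at hp
        rcases hp with (((hp | hp) | hp) | hp) | hp
        exacts [hm _ h1 p hp, hm _ h1 p hp, hm _ h2 p hp, hm _ h1 p hp, hm _ h1 p hp]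
  unfold trotterStages at hp
  split_ifs at hp
  · simp only [List.mem_cons, List.not_mem_nil, or_false] at hp
    subst hp
    norm_num
  · exact key _ p hp

theorem abs_stepCoeff_le {K L : ℕ} (γ : Fin (stepCount K L)) : |stepCoeff K L γ| ≤ 1 := by
  have h1 : (trotterSteps K L).get γ ∈ trotterSteps K L := List.get_mem _ _
  obtain ⟨p, hp, hq⟩ := List.mem_flatMap.1 h1
  obtain ⟨l, _, hl⟩ := List.mem_map.1 hq
  rw [stepCoeff, ← hl]
  exact abs_trotterStages_le hp

/-- Every summand occurs once in each stage. -/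
theorem sum_stepOp {n L K : ℕ} (hK : K = 1 ∨ (Even K ∧ 0 < K)) (h : Fin L → Op n)
    (f : Op n → ℝ) :
    ∑ γ, f (stepOp K h γ) = (stageCount K : ℝ) * ∑ l, f (h l) := by
  have key : ∀ S : List (ℝ × Bool),
      ((S.flatMap (stageSteps L)).map fun q => f (h q.2)).sum = (S.length : ℝ) * ∑ l, f (h l) := by
    intro S
    induction S with
    | nil => simp
    | cons p S ih =>
      have h1 : ((stageSteps L p).map fun q => f (h q.2)).sum = ∑ l, f (h l) := by
        unfold stageSteps
        split_ifs <;> simp [Function.comp_def, List.sum_reverse,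
          ← List.ofFn_eq_map, List.sum_ofFn]
      rw [List.flatMap_cons, List.map_append, List.sum_append, ih, h1, List.length_cons]
      push_cast
      ring
  rw [← length_trotterStages hK, ← key, ← List.sum_ofFn]
  congr 1
  rw [← List.ofFn_get (List.map _ _)]
  refine List.ext_get (by simp [stepCount, trotterSteps]) ?_
  intro i h1 h2
  simp [stepOp, trotterSteps]
  rfl

theorem one_le_stageCount (K : ℕ) : (1 : ℝ) ≤ stageCount K := by
  have : 1 ≤ stageCount K := by
    unfold stageCount
    split_ifs
    · exact le_rfl
    · have := Nat.one_le_pow (K / 2 - 1) 5 (by norm_num)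
      omega
  exact_mod_cast this

theorem alphaH_nonneg {n L : ℕ} {ν : Op n → ℝ} (hν : ∀ A, 0 ≤ ν A) (K : ℕ) (h : Fin L → Op n)
    (s : ℕ) : 0 ≤ alphaH ν K h s :=
  Finset.sum_nonneg fun _ _ => Finset.sum_nonneg fun _ _ => mul_nonneg (Nat.cast_nonneg _) (hν _)

/-- All scalar coefficients have modulus at most `1` and can be dropped; a zero coefficient is
replaced by `1`, which extends the products over `γ' > γ` to full ones. The first sum then gives `κ
α`, as each `H_l` occurs `κ` times, and the second gives `α ≤ κ α`. -/
theorem compNorm_le {n L K : ℕ} (hK : K = 1 ∨ (Even K ∧ 0 < K)) (ν : Seminorm ℂ (Op n))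
    (h : Fin L → Op n) (s : ℕ) :
    compNorm ν K h s ≤ 2 * (stageCount K : ℝ) * alphaH ν K h s := by
  have hc : ∀ (P : Fin (stepCount K L) → Prop) [DecidablePred P] (γ : Fin (stepCount K L)),
      ‖(if P γ then -(Complex.I * (stepCoeff K L γ : ℂ)) else 0 : ℂ)‖ ≤ 1 := by
    intro P _ γ
    split_ifs
    · simpa using abs_stepCoeff_le γ
    · simp
  have h1 : ∑ γ : Fin (stepCount K L),
      multiNorm ν (stepGen K h (γ < ·)) s ((stepCoeff K L γ : ℂ) • stepOp K h γ)
        ≤ (stageCount K : ℝ) * alphaH ν K h s := by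
    rw [alphaH, ← sum_stepOp hK h fun B => alphaCom ν s (stepOp K h) B]
    refine Finset.sum_le_sum fun γ _ => ?_
    rw [alphaCom_eq_multiNorm]
    refine (multiNorm_arg_smul_le ν ?_ _ s _).trans (multiNorm_smul_le ν (hc _) _ s _)
    simpa using abs_stepCoeff_le γ
  have h2 : multiNorm ν (stepGen K h fun _ => True) s (∑ l, h l) ≤ alphaH ν K h s := by
    refine (multiNorm_smul_le ν (hc _) _ s _).trans ((multiNorm_sum_le ν _ s h).trans_eq ?_)
    simp only [alphaH, alphaCom_eq_multiNorm]
  have h3 : alphaH ν K h s ≤ (stageCount K : ℝ) * alphaH ν K h s :=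
    le_mul_of_one_le_left (alphaH_nonneg (apply_nonneg ν) K h s) (one_le_stageCount K)
  rw [compNorm]
  linarith

/-! ### Order conditions -/

theorem natCast_le_infty (t : ℕ) : ((t : ℕ∞) : WithTop ℕ∞) ≤ ∞ := by
  exact_mod_cast le_top

/-- The smooth families `f` and `u`, both `1` at `0`, have the same derivatives of order `< p` at
`0`, and `R` is the difference of the derivatives of order `p`. -/
structure AgreeTo {n : ℕ} (p : ℕ) (f u : ℝ → Op n) (R : Op n) : Prop where
  contDiff_left : ContDiff ℝ ∞ f
  contDiff_right : ContDiff ℝ ∞ u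
  left_zero : f 0 = 1
  right_zero : u 0 = 1
  eq_of_lt : ∀ t < p, iteratedDeriv t f 0 = iteratedDeriv t u 0
  eq_add : iteratedDeriv p f 0 = iteratedDeriv p u 0 + R

theorem AgreeTo.of_lt {n p : ℕ} {f u : ℝ → Op n} (hf : ContDiff ℝ ∞ f) (hu : ContDiff ℝ ∞ u)
    (hf0 : f 0 = 1) (hu0 : u 0 = 1) (h : ∀ t < p, iteratedDeriv t f 0 = iteratedDeriv t u 0) :
    AgreeTo p f u (iteratedDeriv p f 0 - iteratedDeriv p u 0) :=
  ⟨hf, hu, hf0, hu0, h, by abel⟩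

/-- In the Leibniz formula of order `p ≥ 1` only the two end terms contain a derivative of order
`p`. Their binomial coefficients and the values at `0` are `1`, so the discrepancies add. -/
theorem AgreeTo.mul {n p : ℕ} (hp : p ≠ 0) {f u g v : ℝ → Op n} {R Q : Op n}
    (h : AgreeTo p f u R) (h' : AgreeTo p g v Q) :
    AgreeTo p (fun x => f x * g x) (fun x => u x * v x) (R + Q) where
  contDiff_left := h.contDiff_left.mul h'.contDiff_left
  contDiff_right := h.contDiff_right.mul h'.contDiff_right
  left_zero := by rw [h.left_zero, h'.left_zero, one_mul]
  right_zero := by rw [h.right_zero, h'.right_zero, one_mul]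
  eq_of_lt t ht := by
    rw [iteratedDeriv_fun_mul (h.contDiff_left.contDiffAt.of_le (natCast_le_infty t))
      (h'.contDiff_left.contDiffAt.of_le (natCast_le_infty t)),
      iteratedDeriv_fun_mul (h.contDiff_right.contDiffAt.of_le (natCast_le_infty t))
      (h'.contDiff_right.contDiffAt.of_le (natCast_le_infty t))]
    refine Finset.sum_congr rfl fun i hi => ?_
    have hi' := Finset.mem_range.1 hi
    rw [h.eq_of_lt i (by omega), h'.eq_of_lt (t - i) (by omega)]
  eq_add := by
    rw [iteratedDeriv_fun_mul (h.contDiff_left.contDiffAt.of_le (natCast_le_infty p))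
      (h'.contDiff_left.contDiffAt.of_le (natCast_le_infty p)),
      iteratedDeriv_fun_mul (h.contDiff_right.contDiffAt.of_le (natCast_le_infty p))
      (h'.contDiff_right.contDiffAt.of_le (natCast_le_infty p))]
    obtain ⟨q, rfl⟩ := Nat.exists_eq_succ_of_ne_zero hp
    rw [Finset.sum_range_succ, Finset.sum_range_succ', Finset.sum_range_succ,
      Finset.sum_range_succ' _ q]
    have hmid : ∀ i ∈ Finset.range q, ((q.succ.choose (i + 1) : ℕ) : Op n)
        * iteratedDeriv (i + 1) f 0 * iteratedDeriv (q.succ - (i + 1)) g 0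
        = ((q.succ.choose (i + 1) : ℕ) : Op n)
        * iteratedDeriv (i + 1) u 0 * iteratedDeriv (q.succ - (i + 1)) v 0 := by
      intro i hi
      have hi' := Finset.mem_range.1 hi
      rw [h.eq_of_lt (i + 1) (by omega), h'.eq_of_lt (q.succ - (i + 1)) (by omega)]
    rw [Finset.sum_congr rfl hmid]
    simp only [Nat.sub_zero, Nat.sub_self, Nat.choose_zero_right, Nat.choose_self, Nat.cast_one,
      one_mul, iteratedDeriv_zero, h.left_zero, h'.left_zero, h.right_zero, h'.right_zero, mul_one,
      h.eq_add, h'.eq_add]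
    abel

theorem AgreeTo.comp_mul {n p : ℕ} {f u : ℝ → Op n} {R : Op n} (h : AgreeTo p f u R) (c : ℝ) :
    AgreeTo p (fun x => f (c * x)) (fun x => u (c * x)) (c ^ p • R) where
  contDiff_left := h.contDiff_left.comp (contDiff_const.mul contDiff_id)
  contDiff_right := h.contDiff_right.comp (contDiff_const.mul contDiff_id)
  left_zero := by rw [mul_zero, h.left_zero]
  right_zero := by rw [mul_zero, h.right_zero]
  eq_of_lt t ht := by
    rw [iteratedDeriv_comp_const_smul (h.contDiff_left.of_le (natCast_le_infty t)),
      iteratedDeriv_comp_const_smul (h.contDiff_right.of_le (natCast_le_infty t))]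
    simp only [mul_zero, h.eq_of_lt t ht]
  eq_add := by
    rw [iteratedDeriv_comp_const_smul (h.contDiff_left.of_le (natCast_le_infty p)),
      iteratedDeriv_comp_const_smul (h.contDiff_right.of_le (natCast_le_infty p))]
    simp only [mul_zero, h.eq_add, smul_add]

/-- Agreement of two time-symmetric families to an even order improves by one order. -/
theorem AgreeTo.eq_zero_of_symm {n p : ℕ} (hp : p ≠ 0) (he : Even p) {f u : ℝ → Op n} {R : Op n}
    (h : AgreeTo p f u R) (hf : ∀ x, f x * f (-x) = 1) (hu : ∀ x, u x * u (-x) = 1) : R = 0 := by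
  -- The families `f(x) f(-x)` and `u(x) u(-x)` are both constantly `1`, yet their discrepancy of
  -- order `p` is `R + (-1)^p R = 2R`.
  have h1 := (h.mul hp (h.comp_mul (-1))).eq_add
  simp only [neg_one_mul, hf, hu, he.neg_one_pow, one_smul] at h1
  have h2 : R + R = 0 := by simpa using h1
  have h3 : (2 : ℝ) • R = 0 := by rw [two_smul, h2]
  exact (smul_eq_zero.1 h3).resolve_left two_ne_zero

theorem contDiff_evolution_one {n : ℕ} (A : Op n) : ContDiff ℝ ∞ (evolution A) := by
  simpa using contDiff_evolution A 1

theorem evolution_add {n : ℕ} (A : Op n) (x y : ℝ) :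
    evolution A (x + y) = evolution A x * evolution A y := by
  rw [evolution, evolution, evolution, ← Matrix.exp_add_of_commute]
  · rw [← add_smul]
    congr 2
    push_cast
    ring
  · exact ((Commute.refl A).smul_left _).smul_right _

theorem trotter_two_mul {n L : ℕ} (h : Fin L → Op n) (k : ℕ) (x : ℝ) :
    trotter (2 * k) h x = suzuki h k x := by
  have h1 : ¬ (2 * k = 1) := by omega
  have h2 : 2 * k / 2 = k := by omega
  rw [trotter, if_neg h1, h2]

theorem trotter_mem_unitary {n L : ℕ} (K : ℕ) {h : Fin L → Op n} (hh : ∀ l, (h l).IsHermitian)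
    (x : ℝ) : trotter K h x ∈ unitary (Op n) := by
  rw [trotter_eq_evolutionProd K hh]
  exact evolutionProd_mem_unitary (fun γ => hh _) _ x

theorem contDiff_trotter {n L : ℕ} (K : ℕ) {h : Fin L → Op n} (hh : ∀ l, (h l).IsHermitian) :
    ContDiff ℝ ∞ (trotter K h) := by
  rw [funext (trotter_eq_evolutionProd K hh)]
  exact contDiff_evolutionProd _ _

theorem trotter_at_zero {n L : ℕ} (K : ℕ) {h : Fin L → Op n} (hh : ∀ l, (h l).IsHermitian) :
    trotter K h 0 = 1 := by
  rw [trotter_eq_evolutionProd K hh, evolutionProd_at_zero]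

/-- The formulas are palindromic, so adjacent factors cancel from the middle outwards; this time
symmetry yields the even orders. -/
theorem suzuki_mul_neg {n L : ℕ} {h : Fin L → Op n} (hh : ∀ l, (h l).IsHermitian) (k : ℕ) (x : ℝ) :
    suzuki h k x * suzuki h k (-x) = 1 := by
  induction k generalizing x with
  | zero => simp [suzuki]
  | succ k ih =>
    cases k with
    | zero =>
      have hu : ∀ y, trotterOne h y * (trotterOne h y)ᴴ = 1 ∧
          (trotterOne h y)ᴴ * trotterOne h y = 1 := by
        intro y
        have := Unitary.mem_iff.1 (trotter_mem_unitary 1 hh y)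
        simp only [trotter, if_true, Matrix.star_eq_conjTranspose] at this
        exact ⟨this.2, this.1⟩
      simp only [suzuki, neg_neg]
      rw [mul_assoc, ← mul_assoc (trotterOne h (x / 2)), (hu _).1, one_mul, (hu _).2]
    | succ k =>
      have hc : ∀ y (M : Op n), suzuki h (k + 1) y * (suzuki h (k + 1) (-y) * M) = M := by
        intro y M
        rw [← mul_assoc, ih, one_mul]
      simp only [suzuki, mul_neg, pow_two, mul_assoc, hc, ih]

theorem hasDerivAt_evolutionProd_zero {n N : ℕ} (A : Fin N → Op n) (a : Fin N → ℝ) :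
    HasDerivAt (evolutionProd A a) ((-Complex.I) • ∑ γ, (a γ : ℂ) • A γ) 0 := by
  induction N with
  | zero =>
    rw [funext (evolutionProd_zero A a)]
    simpa using hasDerivAt_const (0 : ℝ) (1 : Op n)
  | succ N ih =>
    rw [funext (evolutionProd_castSucc A a)]
    refine ((hasDerivAt_evolution (A (Fin.last N)) (a (Fin.last N)) 0).fun_mul
      (ih (fun i => A i.castSucc) fun i => a i.castSucc)).congr_deriv ?_
    rw [Fin.sum_univ_castSucc, evolutionProd_at_zero, zero_mul, evolution_zero, one_mul, one_mul,
      mul_one, smul_add, smul_smul, neg_mul, add_comm]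

theorem sum_stepCoeff_smul {n L : ℕ} (K : ℕ) (h : Fin L → Op n) :
    ∑ γ, (stepCoeff K L γ : ℂ) • stepOp K h γ
      = ((((trotterStages K).map Prod.fst).sum : ℝ) : ℂ) • ∑ l, h l := by
  have key : ∀ S : List (ℝ × Bool),
      ((S.flatMap (stageSteps L)).map fun q => (q.1 : ℂ) • h q.2).sum
        = (((S.map Prod.fst).sum : ℝ) : ℂ) • ∑ l, h l := by
    intro S
    induction S with
    | nil => simp
    | cons p S ih =>
      have h1 : ((stageSteps L p).map fun q => (q.1 : ℂ) • h q.2).sum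
          = (p.1 : ℂ) • ∑ l, h l := by
        rw [Finset.smul_sum]
        unfold stageSteps
        split_ifs <;> simp [Function.comp_def, List.sum_reverse,
          ← List.ofFn_eq_map, List.sum_ofFn]
      rw [List.flatMap_cons, List.map_append, List.sum_append, ih, h1, List.map_cons,
        List.sum_cons, ← add_smul]
      push_cast
      rfl
  rw [← key, ← List.sum_ofFn]
  congr 1
  rw [← List.ofFn_get (List.map _ _)]
  refine List.ext_get (by simp [stepCount, trotterSteps]) ?_
  intro i h1 h2
  simp [stepOp, stepCoeff, trotterSteps]
  rfl

/-- First-order consistency depends only on the total length of the stages. It settles `K = 1` and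
starts the induction at `K = 2`. -/
theorem iteratedDeriv_trotter_of_lt_two {n L K : ℕ} {h : Fin L → Op n}
    (hh : ∀ l, (h l).IsHermitian) (hK : ((trotterStages K).map Prod.fst).sum = 1) (t : ℕ)
    (ht : t < 2) :
    iteratedDeriv t (trotter K h) 0 = iteratedDeriv t (evolution (∑ l, h l)) 0 := by
  interval_cases t
  · simp [trotter_at_zero K hh, evolution_zero]
  · rw [iteratedDeriv_one, iteratedDeriv_one, funext (trotter_eq_evolutionProd K hh),
      (hasDerivAt_evolutionProd_zero _ _).deriv, sum_stepCoeff_smul, hK]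
    have h1 := hasDerivAt_evolution (∑ l, h l) 1 0
    simp only [mul_one, Complex.ofReal_one, evolution_zero, one_mul] at h1
    rw [h1.deriv]
    simp

/-- The Suzuki formula `S_{2k}` is of order `2k`. -/
theorem iteratedDeriv_suzuki {n L : ℕ} {h : Fin L → Op n} (hh : ∀ l, (h l).IsHermitian) (k : ℕ) :
    ∀ t < 2 * (k + 1) + 1,
      iteratedDeriv t (suzuki h (k + 1)) 0 = iteratedDeriv t (evolution (∑ l, h l)) 0 := by
  have hsm : ∀ k, ContDiff ℝ ∞ (suzuki h k) := fun k => by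
    rw [← funext (trotter_two_mul h k)]
    exact contDiff_trotter _ hh
  have hs0 : ∀ k, suzuki h k 0 = 1 := fun k => by
    rw [← trotter_two_mul h k]
    exact trotter_at_zero _ hh
  set U := evolution (∑ l, h l) with hU
  have hUm : ContDiff ℝ ∞ U := contDiff_evolution_one _
  have hU0 : U 0 = 1 := evolution_zero _
  -- Time symmetry gives the even order `2 (k + 1)` for free once all lower orders agree.
  have himp : ∀ k, (∀ t < 2 * (k + 1), iteratedDeriv t (suzuki h (k + 1)) 0 = iteratedDeriv t U 0) →
      ∀ t < 2 * (k + 1) + 1, iteratedDeriv t (suzuki h (k + 1)) 0 = iteratedDeriv t U 0 := by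
    intro k hk t ht
    rcases Nat.lt_succ_iff_lt_or_eq.1 ht with ht | rfl
    · exact hk t ht
    · exact sub_eq_zero.1 ((AgreeTo.of_lt (hsm _) hUm (hs0 _) hU0 hk).eq_zero_of_symm (by omega)
        (even_two_mul _) (suzuki_mul_neg hh _) (evolution_mul_neg _))
  induction k with
  | zero =>
    refine himp 0 fun t ht => ?_
    have h1 := iteratedDeriv_trotter_of_lt_two (K := 2 * 1) hh
      (by norm_num [trotterStages, suzukiStages]) t ht
    rwa [funext (trotter_two_mul h 1)] at h1
  | succ k ih =>
    refine himp (k + 1) ?_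
    set c := suzukiParam (k + 2) with hc
    set R := iteratedDeriv (2 * (k + 1) + 1) (suzuki h (k + 1)) 0
      - iteratedDeriv (2 * (k + 1) + 1) U 0 with hR
    have hA : AgreeTo (2 * (k + 1) + 1) (suzuki h (k + 1)) U R :=
      AgreeTo.of_lt (hsm _) hUm (hs0 _) hU0 ih
    have hp : 2 * (k + 1) + 1 ≠ 0 := by omega
    have h1 := hA.comp_mul c
    have h2 := hA.comp_mul (1 - 4 * c)
    have h3 := ((h1.mul hp h1).mul hp h2).mul hp (h1.mul hp h1)
    have hs : (fun x => suzuki h (k + 1) (c * x) * suzuki h (k + 1) (c * x)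
        * suzuki h (k + 1) ((1 - 4 * c) * x)
        * (suzuki h (k + 1) (c * x) * suzuki h (k + 1) (c * x))) = suzuki h (k + 1 + 1) := by
      funext x
      simp only [suzuki, pow_two, hc]
    -- The five sub-steps have total length `1`, so the exact evolution factors in the same way and
    -- can be compared factor by factor.
    have hu : (fun x => U (c * x) * U (c * x) * U ((1 - 4 * c) * x)
        * (U (c * x) * U (c * x))) = U := by
      funext x
      simp only [hU, ← evolution_add]
      congr 1
      ring
    rw [hs, hu] at h3
    -- The total discrepancy is `(4 c^p + (1 - 4c)^p) R` with `p = 2 (k + 1) + 1`; the Suzuki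
    -- parameter is chosen to annihilate this factor.
    have hz : c ^ (2 * (k + 1) + 1) • R + c ^ (2 * (k + 1) + 1) • R
        + (1 - 4 * c) ^ (2 * (k + 1) + 1) • R
        + (c ^ (2 * (k + 1) + 1) • R + c ^ (2 * (k + 1) + 1) • R) = 0 := by
      have h4 := (suzukiParam_mem (k := k + 2) (by omega)).2.2
      rw [show 2 * (k + 2) - 1 = 2 * (k + 1) + 1 by omega, ← hc] at h4
      have h5 : (4 * c ^ (2 * (k + 1) + 1) + (1 - 4 * c) ^ (2 * (k + 1) + 1)) • R = 0 := by
        rw [h4, zero_smul]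
      rw [← h5]
      module
    intro t ht
    rcases Nat.lt_succ_iff_lt_or_eq.1 (show t < (2 * (k + 1) + 1) + 1 by omega) with ht | rfl
    · exact h3.eq_of_lt t ht
    · rw [h3.eq_add, hz, add_zero]

/-- The `K`th-order Trotter formula is of order `K`. -/
theorem iteratedDeriv_trotter {n L K : ℕ} (hK : K = 1 ∨ (Even K ∧ 0 < K)) {h : Fin L → Op n}
    (hh : ∀ l, (h l).IsHermitian) (t : ℕ) (ht : t < K + 1) :
    iteratedDeriv t (trotter K h) 0 = iteratedDeriv t (evolution (∑ l, h l)) 0 := by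
  rcases hK with rfl | ⟨⟨m, rfl⟩, hpos⟩
  · exact iteratedDeriv_trotter_of_lt_two hh (by simp [trotterStages]) t ht
  · obtain ⟨k, rfl⟩ : ∃ k, m = k + 1 := ⟨m - 1, by omega⟩
    rw [← two_mul, funext (trotter_two_mul h (k + 1))]
    exact iteratedDeriv_suzuki hh k t (by omega)

/-! ### The Trotter remainder -/

theorem trotterRemainder_mem_unitary {n L : ℕ} (K : ℕ) {h : Fin L → Op n}
    (hh : ∀ l, (h l).IsHermitian) (x : ℝ) : trotterRemainder K h x ∈ unitary (Op n) :=
  mul_mem (evolution_mem_unitary (isSelfAdjoint_sum _ fun l _ => hh l) x)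
    (Unitary.star_mem (trotter_mem_unitary K hh x))

theorem contDiff_trotterRemainder {n L : ℕ} (K : ℕ) {h : Fin L → Op n}
    (hh : ∀ l, (h l).IsHermitian) : ContDiff ℝ ∞ (trotterRemainder K h) :=
  (contDiff_evolution_one _).mul (contDiff_conjTranspose (contDiff_trotter K hh))

theorem trotterRemainder_at_zero {n L : ℕ} (K : ℕ) {h : Fin L → Op n}
    (hh : ∀ l, (h l).IsHermitian) : trotterRemainder K h 0 = 1 := by
  rw [trotterRemainder, trotter_at_zero K hh, evolution_zero]
  simp

/-- The product rule with `S† S = 1` inserted after `U`; the commutator form of `J` enters the error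
analysis through this equation. -/
theorem hasDerivAt_trotterRemainder {n L : ℕ} (K : ℕ) {h : Fin L → Op n}
    (hh : ∀ l, (h l).IsHermitian) (x : ℝ) :
    HasDerivAt (trotterRemainder K h) (trotterRemainder K h x * derivRemainder K h x) x := by
  have h1 := hasDerivAt_evolution (∑ l, h l) 1 x
  simp only [mul_one, Complex.ofReal_one] at h1
  have h2 : HasDerivAt (fun y => (trotter K h y)ᴴ) (deriv (fun y => (trotter K h y)ᴴ) x) x :=
    ((contDiff_conjTranspose (contDiff_trotter K hh)).differentiable
      (by simp)).differentiableAt.hasDerivAt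
  have h3 := (Unitary.mem_iff.1 (trotter_mem_unitary K hh x)).1
  rw [Matrix.star_eq_conjTranspose] at h3
  refine (h1.fun_mul h2).congr_deriv ?_
  rw [trotterRemainder, derivRemainder, mul_assoc (evolution _ _) (trotter K h x)ᴴ,
    ← mul_assoc (trotter K h x)ᴴ, h3,
    one_mul, mul_sub]
  simp only [mul_smul_comm, neg_smul, mul_neg, neg_mul, smul_mul_assoc, mul_assoc]
  abel

/-- `J_K` is anti-Hermitian. -/
theorem derivRemainder_conjTranspose {n L : ℕ} (K : ℕ) {h : Fin L → Op n}
    (hh : ∀ l, (h l).IsHermitian) (x : ℝ) :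
    (derivRemainder K h x)ᴴ = -derivRemainder K h x := by
  have h1 := hasDerivAt_trotterRemainder K hh x
  have h2 : HasDerivAt (fun y => (trotterRemainder K h y)ᴴ)
      (trotterRemainder K h x * derivRemainder K h x)ᴴ x :=
    ((starL' ℝ : Op n ≃L[ℝ] Op n) : Op n →L[ℝ] Op n).hasFDerivAt.comp_hasDerivAt x h1
  have h3 : ∀ y, (trotterRemainder K h y)ᴴ * trotterRemainder K h y = 1 := fun y =>
    (Unitary.mem_iff.1 (trotterRemainder_mem_unitary K hh y)).1
  -- Differentiating `V† V = 1` gives `J† V† V + V† V J = 0`.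
  have h4 := (h2.fun_mul h1).unique ((hasDerivAt_const x (1 : Op n)).congr_of_eventuallyEq
    (Filter.Eventually.of_forall h3))
  rw [Matrix.conjTranspose_mul, mul_assoc, ← mul_assoc _ _ (derivRemainder K h x), h3, mul_one,
    one_mul] at h4
  exact eq_neg_of_add_eq_zero_left h4

theorem compCoeff_conjTranspose {n L : ℕ} (K : ℕ) {h : Fin L → Op n}
    (hh : ∀ l, (h l).IsHermitian) (s : ℕ) : (compCoeff K h s)ᴴ = -compCoeff K h s := by
  rw [compCoeff_eq_iteratedDeriv K hh]
  have h1 := iteratedDeriv_clm_apply ((starL' ℝ : Op n ≃L[ℝ] Op n) : Op n →L[ℝ] Op n) s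
    (contDiff_derivRemainder K hh) 0
  have h2 : (fun y => ((starL' ℝ : Op n ≃L[ℝ] Op n) : Op n →L[ℝ] Op n) (derivRemainder K h y))
      = -derivRemainder K h := funext fun y => derivRemainder_conjTranspose K hh y
  rw [h2, iteratedDeriv_neg] at h1
  exact h1.symm

theorem iteratedDeriv_mul_eq_zero {n p : ℕ} {f g : ℝ → Op n} (hf : ContDiff ℝ ∞ f)
    (hg : ContDiff ℝ ∞ g)
    (h : (∀ t < p, iteratedDeriv t f 0 = 0) ∨ (∀ t < p, iteratedDeriv t g 0 = 0)) (t : ℕ)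
    (ht : t < p) : iteratedDeriv t (fun x => f x * g x) 0 = 0 := by
  rw [iteratedDeriv_fun_mul (hf.contDiffAt.of_le (natCast_le_infty t))
    (hg.contDiffAt.of_le (natCast_le_infty t))]
  refine Finset.sum_eq_zero fun i hi => ?_
  have hi' := Finset.mem_range.1 hi
  rcases h with h | h
  · rw [h i (by omega), mul_zero, zero_mul]
  · rw [h (t - i) (by omega), mul_zero]

/-- The coefficients below the order of the Trotter formula vanish. -/
theorem compCoeff_eq_zero {n L K : ℕ} (hK : K = 1 ∨ (Even K ∧ 0 < K)) {h : Fin L → Op n}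
    (hh : ∀ l, (h l).IsHermitian) {s : ℕ} (hs : s < K) : compCoeff K h s = 0 := by
  rw [compCoeff_eq_iteratedDeriv K hh]
  have hS := contDiff_trotter K hh
  have hSs := contDiff_conjTranspose hS
  have hU := contDiff_evolution_one (∑ l, h l)
  have hV := contDiff_trotterRemainder K hh
  have h1 : ∀ t < K + 1, iteratedDeriv t (fun x => evolution (∑ l, h l) x - trotter K h x) 0 = 0 := by
    intro t ht
    have := iteratedDeriv_sub (n := t) (x := (0 : ℝ))
      (hU.contDiffAt.of_le (natCast_le_infty t)) (hS.contDiffAt.of_le (natCast_le_infty t))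
    rw [iteratedDeriv_trotter hK hh t ht, sub_self] at this
    exact this
  have h2 := iteratedDeriv_mul_eq_zero (hU.sub hS) hSs (Or.inl h1)
  -- Since `V - 1 = (U - S) S†`, its derivatives up to order `K` vanish at `0`. Those of `V'`, and
  -- of `J = V† V'`, then vanish below order `K`.
  have h3 : (fun x => (evolution (∑ l, h l) x - trotter K h x) * (trotter K h x)ᴴ)
      = fun x => trotterRemainder K h x - 1 := by
    funext x
    have := (Unitary.mem_iff.1 (trotter_mem_unitary K hh x)).2
    rw [Matrix.star_eq_conjTranspose] at this
    rw [sub_mul, this, trotterRemainder]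
  rw [h3] at h2
  have h4 : deriv (fun x => trotterRemainder K h x - 1) = deriv (trotterRemainder K h) := by
    funext x
    rw [deriv_sub_const]
  have h5 : ∀ t < K, iteratedDeriv t (deriv (trotterRemainder K h)) 0 = 0 := by
    intro t ht
    rw [← h4, ← iteratedDeriv_succ']
    exact h2 (t + 1) (by omega)
  have h6 := iteratedDeriv_mul_eq_zero (contDiff_conjTranspose hV) (contDiff_deriv hV) (Or.inr h5)
    s hs
  have h7 : (fun x => (trotterRemainder K h x)ᴴ * deriv (trotterRemainder K h) x)
      = derivRemainder K h := by
    funext x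
    have := (Unitary.mem_iff.1 (trotterRemainder_mem_unitary K hh x)).1
    rw [Matrix.star_eq_conjTranspose] at this
    rw [(hasDerivAt_trotterRemainder K hh x).deriv, ← mul_assoc, this, one_mul]
  rwa [h7] at h6

theorem sum_Icc_succ_eq {M : Type*} [AddCommMonoid M] (K : ℕ) (f : ℕ → M) :
    ∑ s ∈ Finset.Icc (K + 1) (2 * K + 1), f s = ∑ s ∈ Finset.Icc K (2 * K), f (s + 1) := by
  refine Finset.sum_nbij' (· - 1) (· + 1) ?_ ?_ ?_ ?_ ?_ <;>
    simp only [Finset.mem_Icc] <;> intro s hs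
  · omega
  · omega
  · omega
  · omega
  · rw [Nat.sub_add_cancel (by omega)]

/-- The added terms `s < K` are zero by the order condition. In this form the derivative is visibly
the Taylor polynomial of `J` of degree `2K`. -/
theorem compensation_eq {n L K : ℕ} (hK : K = 1 ∨ (Even K ∧ 0 < K)) {h : Fin L → Op n}
    (hh : ∀ l, (h l).IsHermitian) (x : ℝ) :
    compensation K h x = 1 + ∑ s ∈ Finset.range (2 * K + 1),
      (x ^ (s + 1) / ((s + 1).factorial : ℝ)) • compCoeff K h s := by
  rw [compensation, sum_Icc_succ_eq K fun s =>
    ((x ^ s / (s.factorial : ℝ) : ℝ) : ℂ) • compCoeff K h (s - 1)]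
  congr 1
  refine Finset.sum_subset_zero_on_sdiff ?_ ?_ ?_
  · intro s hs
    rw [Finset.mem_Icc] at hs
    rw [Finset.mem_range]
    omega
  · intro s hs
    simp only [Finset.mem_sdiff, Finset.mem_range, Finset.mem_Icc] at hs
    rw [compCoeff_eq_zero hK hh (by omega), smul_zero]
  · intro s _
    rw [Nat.add_sub_cancel, Complex.coe_smul]

theorem norm_derivRemainder_le {n L K : ℕ} (hK : K = 1 ∨ (Even K ∧ 0 < K)) {h : Fin L → Op n}
    (hh : ∀ l, (h l).IsHermitian) {x : ℝ} (hx : 0 ≤ x) :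
    ‖derivRemainder K h x‖ ≤ x ^ K / (K.factorial : ℝ) * compNorm (fun A => ‖A‖) K h K := by
  have h1 := norm_derivRemainder_sub_taylor_le K hh K hx
  rwa [Finset.sum_eq_zero fun s hs => by
    rw [compCoeff_eq_zero hK hh (Finset.mem_range.1 hs), smul_zero], sub_zero] at h1

/-- As `V` is unitary, `‖V'‖ = ‖J‖`, and the bound on `J` is integrated from `0`. -/
theorem norm_trotterRemainder_sub_one_le {n L K : ℕ} (hK : K = 1 ∨ (Even K ∧ 0 < K))
    {h : Fin L → Op n} (hh : ∀ l, (h l).IsHermitian) {x : ℝ} (hx : 0 ≤ x) :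
    ‖trotterRemainder K h x - 1‖
      ≤ x ^ (K + 1) / ((K + 1).factorial : ℝ) * compNorm (fun A => ‖A‖) K h K := by
  have hd := fun y => (hasDerivAt_trotterRemainder K hh y).sub_const (1 : Op n)
  refine image_norm_le_of_norm_deriv_right_le_deriv_boundary (a := 0) (b := x)
    (B := fun y => y ^ (K + 1) / ((K + 1).factorial : ℝ) * compNorm (fun A => ‖A‖) K h K)
    (fun y _ => (hd y).continuousAt.continuousWithinAt) (fun y _ => (hd y).hasDerivWithinAt)
    ?_ (fun y => (hasDerivAt_pow_div_factorial K y).mul_const _) ?_ ⟨hx, le_rfl⟩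
  · simp [trotterRemainder_at_zero K hh]
  · intro y hy
    rw [CStarRing.norm_mem_unitary_mul _ (trotterRemainder_mem_unitary K hh y)]
    exact norm_derivRemainder_le hK hh hy.1

theorem norm_trotterRemainder_sub_compensation_le {n L K : ℕ} (hK : K = 1 ∨ (Even K ∧ 0 < K))
    {h : Fin L → Op n} (hh : ∀ l, (h l).IsHermitian) {x : ℝ} (hx : 0 ≤ x) :
    ‖trotterRemainder K h x - compensation K h x‖
      ≤ x ^ (2 * K + 2) / ((2 * K + 2).factorial : ℝ) * compNorm (fun A => ‖A‖) K h (2 * K + 1)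
        + x ^ (2 * K + 2) / ((K.factorial : ℝ) * ((K + 1).factorial : ℝ) * ((2 * K + 2 : ℕ) : ℝ))
          * compNorm (fun A => ‖A‖) K h K ^ 2 := by
  set c := compNorm (fun A : Op n => ‖A‖) K h K with hc
  set d := compNorm (fun A : Op n => ‖A‖) K h (2 * K + 1) with hd
  have hder : ∀ y, HasDerivAt (fun y => trotterRemainder K h y - compensation K h y)
      (trotterRemainder K h y * derivRemainder K h y
        - ∑ s ∈ Finset.range (2 * K + 1), (y ^ s / (s.factorial : ℝ)) • compCoeff K h s) y := by
    intro y
    refine (hasDerivAt_trotterRemainder K hh y).sub ?_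
    rw [funext (compensation_eq hK hh)]
    exact (HasDerivAt.fun_sum fun s _ =>
      (hasDerivAt_pow_div_factorial s y).smul_const _).const_add _
  refine image_norm_le_of_norm_deriv_right_le_deriv_boundary (a := 0) (b := x)
    (B := fun y => y ^ (2 * K + 2) / ((2 * K + 2).factorial : ℝ) * d
      + y ^ (2 * K + 2) / ((K.factorial : ℝ) * ((K + 1).factorial : ℝ) * ((2 * K + 2 : ℕ) : ℝ))
        * c ^ 2)
    (B' := fun y => y ^ (2 * K + 1) / ((2 * K + 1).factorial : ℝ) * d
      + y ^ (2 * K + 1) / ((K.factorial : ℝ) * ((K + 1).factorial : ℝ)) * c ^ 2)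
    (fun y _ => (hder y).continuousAt.continuousWithinAt) (fun y _ => (hder y).hasDerivWithinAt)
    ?_ (fun y => ((hasDerivAt_pow_div_factorial (2 * K + 1) y).mul_const _).add
      (HasDerivAt.mul_const ?_ _)) ?_ ⟨hx, le_rfl⟩
  · simp [trotterRemainder_at_zero K hh, compensation_eq hK hh]
  · refine ((hasDerivAt_pow (2 * K + 2) y).div_const _).congr_deriv ?_
    have h1 : ((2 * K + 2 : ℕ) : ℝ) ≠ 0 := by positivity
    rw [show 2 * K + 2 - 1 = 2 * K + 1 by omega]
    field_simp
  · intro y hy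
    -- Separating `V = 1 + (V - 1)` leaves a Taylor remainder of `J` and a product of two quantities
    -- of orders `K + 1` and `K`.
    have hsplit : trotterRemainder K h y * derivRemainder K h y
        - ∑ s ∈ Finset.range (2 * K + 1), (y ^ s / (s.factorial : ℝ)) • compCoeff K h s
        = (derivRemainder K h y
          - ∑ s ∈ Finset.range (2 * K + 1), (y ^ s / (s.factorial : ℝ)) • compCoeff K h s)
          + (trotterRemainder K h y - 1) * derivRemainder K h y := by
      rw [sub_mul, one_mul]
      abel
    rw [hsplit]
    refine (norm_add_le _ _).trans (add_le_add
      (norm_derivRemainder_sub_taylor_le K hh (2 * K + 1) hy.1) ?_)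
    refine (norm_mul_le _ _).trans ((mul_le_mul (norm_trotterRemainder_sub_one_le hK hh hy.1)
      (norm_derivRemainder_le hK hh hy.1) (norm_nonneg _)
      ((norm_nonneg _).trans (norm_trotterRemainder_sub_one_le hK hh hy.1))).trans_eq ?_)
    rw [← hc]
    have h1 : (K.factorial : ℝ) ≠ 0 := by positivity
    have h2 : ((K + 1).factorial : ℝ) ≠ 0 := by positivity
    field_simp
    ring

/-- The error bound. -/
theorem norm_trotterRemainder_sub_compensation_le_alphaH {n L K : ℕ}
    (hK : K = 1 ∨ (Even K ∧ 0 < K)) {h : Fin L → Op n} (hh : ∀ l, (h l).IsHermitian) {x : ℝ}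
    (hx : 0 ≤ x) :
    ‖trotterRemainder K h x - compensation K h x‖ ≤
      4 * (stageCount K : ℝ) ^ 2 * alphaH (fun A => ‖A‖) K h K *
          (∑ s ∈ Finset.Icc K (2 * K),
            alphaH (fun A => ‖A‖) K h s *
              (x ^ (s + K + 2) /
                ((s.factorial : ℝ) * ((K + 1).factorial : ℝ) * ((s + K + 2 : ℕ) : ℝ)))) +
        2 * (stageCount K : ℝ) * (x ^ (2 * K + 2) / ((2 * K + 2).factorial : ℝ)) *
          alphaH (fun A => ‖A‖) K h (2 * K + 1) := by
  have hα : ∀ s, 0 ≤ alphaH (fun A : Op n => ‖A‖) K h s := alphaH_nonneg norm_nonneg K h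
  have hle : ∀ s, compNorm (fun A : Op n => ‖A‖) K h s
      ≤ 2 * (stageCount K : ℝ) * alphaH (fun A => ‖A‖) K h s :=
    compNorm_le hK (normSeminorm ℂ (Op n)) h
  have hnn : 0 ≤ compNorm (fun A : Op n => ‖A‖) K h K :=
    (norm_nonneg (compCoeff K h K)).trans (seminorm_compCoeff_le (normSeminorm ℂ (Op n)) K h K)
  -- The quadratic part of the estimate is already covered by the summand `s = K`; the other
  -- summands are nonnegative slack.
  have hfirst : alphaH (fun A : Op n => ‖A‖) K h K * (x ^ (K + K + 2) /
        ((K.factorial : ℝ) * ((K + 1).factorial : ℝ) * ((K + K + 2 : ℕ) : ℝ)))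
      ≤ ∑ s ∈ Finset.Icc K (2 * K), alphaH (fun A : Op n => ‖A‖) K h s * (x ^ (s + K + 2) /
          ((s.factorial : ℝ) * ((K + 1).factorial : ℝ) * ((s + K + 2 : ℕ) : ℝ))) :=
    Finset.single_le_sum (f := fun s => alphaH (fun A : Op n => ‖A‖) K h s * (x ^ (s + K + 2) /
          ((s.factorial : ℝ) * ((K + 1).factorial : ℝ) * ((s + K + 2 : ℕ) : ℝ))))
      (fun s _ => mul_nonneg (hα s) (by positivity)) (Finset.mem_Icc.2 ⟨le_rfl, by omega⟩)
  refine (norm_trotterRemainder_sub_compensation_le hK hh hx).trans ?_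
  rw [add_comm]
  refine add_le_add ?_ ?_
  · have h2 : 0 ≤ 4 * (stageCount K : ℝ) ^ 2 * alphaH (fun A : Op n => ‖A‖) K h K :=
      mul_nonneg (by positivity) (hα K)
    refine le_trans ?_ (mul_le_mul_of_nonneg_left hfirst h2)
    refine (mul_le_mul_of_nonneg_left (pow_le_pow_left₀ hnn (hle K) 2) (by positivity)).trans_eq ?_
    rw [two_mul K]
    ring
  · refine (mul_le_mul_of_nonneg_left (hle _) (by positivity)).trans_eq ?_
    ring

/-! ### The bound on the coefficient of the formula. -/

theorem etaSum_eq {n L : ℕ} (ν : Op n → ℝ) (K : ℕ) (h : Fin L → Op n) (x : ℝ) :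
    etaSum ν K h x = ∑ s ∈ Finset.Icc K (2 * K),
      ν (compCoeff K h s) * (x ^ (s + 1) / ((s + 1).factorial : ℝ)) := by
  rw [etaSum, sum_Icc_succ_eq K fun s => ν (compCoeff K h (s - 1)) * (x ^ s / (s.factorial : ℝ))]
  rfl

/-- A bound on the `ν (C_s)` gives the bound on the `1`-norm of the formula. -/
theorem sqrt_one_add_etaSum_sq_le {n L : ℕ} {ν : Op n → ℝ} (K : ℕ) (h : Fin L → Op n)
    (hν : ∀ A, 0 ≤ ν A)
    (hle : ∀ s, ν (compCoeff K h s) ≤ 2 * (stageCount K : ℝ) * alphaH ν K h s) {x : ℝ}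
    (hx : 0 ≤ x) :
    Real.sqrt (1 + etaSum ν K h x ^ 2) ≤ Real.sqrt (1 + 4 * (stageCount K : ℝ) ^ 2 *
        (∑ s ∈ Finset.Icc K (2 * K),
          alphaH ν K h s * (x ^ (s + 1) / ((s + 1).factorial : ℝ))) ^ 2) := by
  refine Real.sqrt_le_sqrt (add_le_add le_rfl ?_)
  have h0 : 0 ≤ etaSum ν K h x :=
    Finset.sum_nonneg fun s _ => mul_nonneg (hν _) (by positivity)
  have h1 : etaSum ν K h x ≤ 2 * (stageCount K : ℝ) * ∑ s ∈ Finset.Icc K (2 * K),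
      alphaH ν K h s * (x ^ (s + 1) / ((s + 1).factorial : ℝ)) := by
    rw [etaSum_eq, Finset.mul_sum]
    refine Finset.sum_le_sum fun s _ => ?_
    rw [← mul_assoc]
    exact mul_le_mul_of_nonneg_right (hle s) (by positivity)
  refine (pow_le_pow_left₀ h0 h1 2).trans_eq ?_
  ring

/-! ### Pauli strings -/

theorem pauli_conj (k : Fin 4) (a b : Fin 2) : star (pauli k b a) = pauli k a b := by
  fin_cases k <;> fin_cases a <;> fin_cases b <;> simp [pauli]

theorem pauli_mul_self (k : Fin 4) : pauli k * pauli k = 1 := by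
  fin_cases k <;> simp [pauli, Matrix.one_fin_two]

/-- The completeness relation: the sum of `P ⊗ P` over the Pauli matrices is twice the swap. Its
tensor power yields the Pauli expansion. -/
theorem sum_pauli_mul_pauli (a b c d : Fin 2) :
    ∑ k, pauli k a b * pauli k c d = if a = d ∧ b = c then 2 else 0 := by
  fin_cases a <;> fin_cases b <;> fin_cases c <;> fin_cases d <;>
    simp [pauli, Fin.sum_univ_four] <;> norm_num

theorem pauliString_isHermitian {n : ℕ} (σ : Fin n → Fin 4) : (pauliString σ).IsHermitian := by
  ext a b
  simp only [pauliString, Matrix.conjTranspose_apply, Matrix.of_apply, star_prod, pauli_conj]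

theorem pauliString_mul_self {n : ℕ} (σ : Fin n → Fin 4) :
    pauliString σ * pauliString σ = 1 := by
  ext a b
  have h1 : ∀ i, ∑ k, pauli (σ i) (a i) k * pauli (σ i) k (b i) = if a i = b i then 1 else 0 := by
    intro i
    rw [← Matrix.mul_apply, pauli_mul_self, Matrix.one_apply]
  simp only [pauliString, Matrix.mul_apply, Matrix.of_apply, ← Finset.prod_mul_distrib]
  rw [← Fintype.prod_sum fun i k => pauli (σ i) (a i) k * pauli (σ i) k (b i)]
  simp only [h1, Matrix.one_apply, Finset.prod_ite_zero, Finset.prod_const_one, Finset.mem_univ,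
    true_imp_iff, funext_iff]

theorem sum_pauliString_mul_pauliString {n : ℕ} (a b c d : Fin n → Fin 2) :
    ∑ σ : Fin n → Fin 4, pauliString σ a b * pauliString σ c d
      = if a = d ∧ b = c then (2 : ℂ) ^ n else 0 := by
  simp only [pauliString, Matrix.of_apply, ← Finset.prod_mul_distrib]
  rw [← Fintype.prod_sum fun i k => pauli k (a i) (b i) * pauli k (c i) (d i)]
  simp only [sum_pauli_mul_pauli, Finset.prod_ite_zero, Finset.prod_const, Finset.card_univ,
    Fintype.card_fin, Finset.mem_univ, true_imp_iff, funext_iff, forall_and]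

/-- The Pauli expansion. -/
theorem sum_pauliCoeff_smul {n : ℕ} (V : Op n) : ∑ σ, pauliCoeff V σ • pauliString σ = V := by
  ext a b
  have h2 : (2 : ℂ) ^ n ≠ 0 := pow_ne_zero _ two_ne_zero
  rw [Matrix.sum_apply]
  simp only [Matrix.smul_apply, smul_eq_mul, pauliCoeff, Matrix.trace, Matrix.diag_apply,
    Matrix.mul_apply]
  have h1 : ∀ σ : Fin n → Fin 4, (∑ c, ∑ d, pauliString σ c d * V d c) / (2 : ℂ) ^ n
        * pauliString σ a b
      = ∑ c, ∑ d, pauliString σ a b * pauliString σ c d * (V d c / (2 : ℂ) ^ n) := by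
    intro σ
    rw [div_mul_eq_mul_div, Finset.sum_mul, Finset.sum_div]
    refine Finset.sum_congr rfl fun c _ => ?_
    rw [Finset.sum_mul, Finset.sum_div]
    refine Finset.sum_congr rfl fun d _ => ?_
    ring
  simp only [h1]
  rw [Finset.sum_comm]
  have h3 : ∀ c, ∑ σ : Fin n → Fin 4, ∑ d,
      pauliString σ a b * pauliString σ c d * (V d c / (2 : ℂ) ^ n)
      = if b = c then V a c else 0 := by
    intro c
    rw [Finset.sum_comm]
    simp only [← Finset.sum_mul, sum_pauliString_mul_pauliString]
    by_cases hbc : b = c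
    · simp [hbc, h2, mul_div_cancel₀]
    · simp [hbc]
  simp only [h3]
  simp

theorem pauliCoeff_add {n : ℕ} (V W : Op n) (σ : Fin n → Fin 4) :
    pauliCoeff (V + W) σ = pauliCoeff V σ + pauliCoeff W σ := by
  rw [pauliCoeff, mul_add, Matrix.trace_add, add_div]
  rfl

theorem pauliCoeff_smul {n : ℕ} (c : ℂ) (V : Op n) (σ : Fin n → Fin 4) :
    pauliCoeff (c • V) σ = c * pauliCoeff V σ := by
  rw [pauliCoeff, mul_smul_comm, Matrix.trace_smul, smul_eq_mul, mul_div_assoc]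
  rfl

/-- The Pauli `1`-norm as a seminorm. -/
def pauliSeminorm (n : ℕ) : Seminorm ℂ (Op n) :=
  Seminorm.of pauliNorm
    (fun V W => by
      simp only [pauliNorm, pauliCoeff_add, ← Finset.sum_add_distrib]
      exact Finset.sum_le_sum fun σ _ => norm_add_le _ _)
    (fun c V => by simp only [pauliNorm, pauliCoeff_smul, norm_mul, Finset.mul_sum])

theorem pauliNorm_nonneg {n : ℕ} (V : Op n) : 0 ≤ pauliNorm V :=
  Finset.sum_nonneg fun _ _ => norm_nonneg _

theorem pauliNorm_eq_zero {n : ℕ} {V : Op n} (h : pauliNorm V = 0) : V = 0 := by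
  have h1 := (Finset.sum_eq_zero_iff_of_nonneg fun σ _ => norm_nonneg (pauliCoeff V σ)).1 h
  rw [← sum_pauliCoeff_smul V]
  refine Finset.sum_eq_zero fun σ hσ => ?_
  rw [norm_eq_zero.1 (h1 σ hσ), zero_smul]

/-! ### Pauli rotations and mixtures of them. -/

/-- `exp (i θ P) = cos θ + i sin θ P` for an involution `P`. -/
theorem exp_smul_involution {n : ℕ} {P : Op n} (hP : P * P = 1) (θ : ℝ) :
    NormedSpace.exp ((Complex.I * (θ : ℂ)) • P)
      = (Real.cos θ : ℂ) • (1 : Op n) + (Complex.I * (Real.sin θ : ℂ)) • P := by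
  set M : Op n := Complex.I • P with hM
  have hMM : M * M = -1 := by
    rw [hM, smul_mul_smul_comm, hP, Complex.I_mul_I, neg_one_smul]
  have hexp : ∀ t : ℝ, (Complex.I * (t : ℂ)) • P = t • M := fun t => by
    rw [hM, ← Complex.coe_smul, smul_smul, mul_comm]
  have hrhs : (Real.cos θ : ℂ) • (1 : Op n) + (Complex.I * (Real.sin θ : ℂ)) • P
      = Real.cos θ • (1 : Op n) + Real.sin θ • M := by
    rw [hexp, Complex.coe_smul]
  rw [hrhs, hexp]
  -- The product of `exp (t M)` with `cos t - M sin t` is constant because `M² = -1`; the second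
  -- factor has inverse `cos t + M sin t`.
  have hd : ∀ t : ℝ, HasDerivAt
      (fun t : ℝ => NormedSpace.exp (t • M) * (Real.cos t • (1 : Op n) - Real.sin t • M)) 0 t := by
    intro t
    refine ((hasDerivAt_exp_smul_const M t).fun_mul
      (((Real.hasDerivAt_cos t).smul_const (1 : Op n)).fun_sub
        ((Real.hasDerivAt_sin t).smul_const M))).congr_deriv ?_
    rw [mul_assoc, ← mul_add, mul_sub, mul_smul_comm, mul_smul_comm, hMM]
    refine Eq.trans (congrArg _ ?_) (mul_zero (NormedSpace.exp (t • M)))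
    simp only [mul_one, smul_neg, neg_smul]
    abel
  have hconst := is_const_of_deriv_eq_zero (fun t => (hd t).differentiableAt)
    (fun t => (hd t).deriv) θ 0
  simp only [zero_smul, NormedSpace.exp_zero, Real.cos_zero, Real.sin_zero, one_smul, sub_zero,
    mul_one] at hconst
  have hinv : (Real.cos θ • (1 : Op n) - Real.sin θ • M)
      * (Real.cos θ • (1 : Op n) + Real.sin θ • M) = 1 := by
    simp only [sub_mul, mul_add, smul_mul_smul_comm, hMM, one_mul, mul_one, smul_neg]
    rw [mul_comm (Real.sin θ) (Real.cos θ)]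
    have : (Real.cos θ * Real.cos θ) • (1 : Op n) + (Real.sin θ * Real.sin θ) • (1 : Op n) = 1 := by
      rw [← add_smul, ← pow_two, ← pow_two, Real.cos_sq_add_sin_sq, one_smul]
    refine Eq.trans ?_ this
    abel
  calc NormedSpace.exp (θ • M)
      = NormedSpace.exp (θ • M) * ((Real.cos θ • (1 : Op n) - Real.sin θ • M)
        * (Real.cos θ • (1 : Op n) + Real.sin θ • M)) := by rw [hinv, mul_one]
    _ = _ := by rw [← mul_assoc, hconst, one_mul]

/-- The pairing step: `cos (arctan η) = 1/√(1+η²)` and `sin (arctan η) = η/√(1+η²)`. Thus a share of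
the identity and an imaginary multiple of `P` merge into one unitary at cost `√(1+η²)` instead of `1
+ η`. -/
theorem sqrt_smul_exp_arctan {n : ℕ} {P : Op n} (hP : P * P = 1) (η : ℝ) :
    (Real.sqrt (1 + η ^ 2) : ℂ) • NormedSpace.exp ((Complex.I * (Real.arctan η : ℂ)) • P)
      = 1 + (Complex.I * (η : ℂ)) • P := by
  have h0 : Real.sqrt (1 + η ^ 2) ≠ 0 := (Real.sqrt_pos.2 (by positivity)).ne'
  rw [exp_smul_involution hP, smul_add, smul_smul, smul_smul, Real.cos_arctan, Real.sin_arctan]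
  congr 1
  · rw [← Complex.ofReal_mul, mul_one_div_cancel h0, Complex.ofReal_one, one_smul]
  · congr 1
    rw [mul_left_comm, ← Complex.ofReal_mul, mul_div_cancel₀ _ h0]

theorem signedPauli_eq {n : ℕ} (C : Op n) (σ : Fin n → Fin 4) :
    ∃ ε : ℝ, (ε = 1 ∨ ε = -1) ∧ signedPauli C σ = (ε : ℂ) • pauliString σ ∧
      ε * |(pauliCoeff C σ).im| = (pauliCoeff C σ).im := by
  unfold signedPauli
  split_ifs with h
  · exact ⟨1, Or.inl rfl, by simp, by rw [abs_of_nonneg h, one_mul]⟩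
  · exact ⟨-1, Or.inr rfl, by simp, by rw [abs_of_neg (not_le.1 h)]; ring⟩

theorem signedPauli_mul_self {n : ℕ} (C : Op n) (σ : Fin n → Fin 4) :
    signedPauli C σ * signedPauli C σ = 1 := by
  unfold signedPauli
  split_ifs <;> simp [pauliString_mul_self]

theorem pauliCoeff_re_eq_zero {n : ℕ} {C : Op n} (hC : Cᴴ = -C) (σ : Fin n → Fin 4) :
    (pauliCoeff C σ).re = 0 := by
  have h1 : star (pauliCoeff C σ) = -pauliCoeff C σ := by
    rw [pauliCoeff, star_div₀, ← Matrix.trace_conjTranspose, Matrix.conjTranspose_mul, hC,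
      (pauliString_isHermitian σ).eq, neg_mul, Matrix.trace_neg, Matrix.trace_mul_comm, neg_div]
    simp
  have h2 := congrArg Complex.re h1
  simp only [Complex.star_def, Complex.conj_re, Complex.neg_re] at h2
  linarith

/-- The Pauli expansion of an anti-Hermitian operator. -/
theorem sum_norm_smul_signedPauli {n : ℕ} {C : Op n} (hC : Cᴴ = -C) :
    ∑ σ, (Complex.I * (‖pauliCoeff C σ‖ : ℂ)) • signedPauli C σ = C := by
  conv_rhs => rw [← sum_pauliCoeff_smul C]
  refine Finset.sum_congr rfl fun σ _ => ?_
  have h0 := pauliCoeff_re_eq_zero hC σ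
  obtain ⟨ε, _, hε, him⟩ := signedPauli_eq C σ
  have hnorm : ‖pauliCoeff C σ‖ = |(pauliCoeff C σ).im| := Complex.abs_im_eq_norm.2 h0 |>.symm
  have hc : pauliCoeff C σ = Complex.I * ((pauliCoeff C σ).im : ℂ) := by
    apply Complex.ext <;> simp [h0]
  rw [hε, smul_smul, hnorm, mul_assoc, ← Complex.ofReal_mul, mul_comm |_|, him, ← hc]

/-- The factor `pauliNorm C` on both sides keeps the identity valid for `C = 0`, where the mixture
has weights `0 / 0 = 0`. -/
theorem pauliNorm_smul_rotationMixture {n : ℕ} {C : Op n} (hC : Cᴴ = -C) (η : ℝ) :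
    (pauliNorm C : ℂ) • (Real.sqrt (1 + η ^ 2) : ℂ) • rotationMixture C η
      = (pauliNorm C : ℂ) • (1 : Op n) + (η : ℂ) • C := by
  rcases eq_or_ne (pauliNorm C) 0 with h0 | h0
  · rw [pauliNorm_eq_zero h0] at *
    simp [h0]
  · have h1 : ∀ σ, (pauliNorm C : ℂ) • (Real.sqrt (1 + η ^ 2) : ℂ) •
        ((‖pauliCoeff C σ‖ / pauliNorm C : ℝ) : ℂ) •
          NormedSpace.exp ((Complex.I * (Real.arctan η : ℂ)) • signedPauli C σ)
        = (‖pauliCoeff C σ‖ : ℂ) • (1 : Op n)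
          + (η : ℂ) • (Complex.I * (‖pauliCoeff C σ‖ : ℂ)) • signedPauli C σ := by
      intro σ
      rw [smul_comm (Real.sqrt (1 + η ^ 2) : ℂ), sqrt_smul_exp_arctan (signedPauli_mul_self C σ),
        smul_smul, ← Complex.ofReal_mul, mul_div_cancel₀ _ h0, smul_add, smul_smul, smul_smul]
      congr 2
      ring
    rw [rotationMixture, Finset.smul_sum, Finset.smul_sum, Finset.sum_congr rfl fun σ _ => h1 σ,
      Finset.sum_add_distrib, ← Finset.smul_sum, sum_norm_smul_signedPauli hC, ← Finset.sum_smul,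
      pauliNorm, Complex.ofReal_sum]

/-! ### Linear combinations of unitaries -/

/-- Indices of weight zero are discarded and the others enumerated, which supplies the positivity
demanded of the probabilities. -/
theorem IsLCUFormulaOver.of_fintype {n : ℕ} {ι : Type*} [Fintype ι] {E : Set (Op n)} {V W : Op n}
    {μ : ℝ} (hμ : 0 < μ) (q : ι → ℝ) (U : ι → Op n) (hq : ∀ i, 0 ≤ q i) (hsum : ∑ i, q i = 1)
    (hU : ∀ i, U i ∈ unitary (Op n)) (hE : ∀ i, U i ∈ E)
    (hW : W = (μ : ℂ) • ∑ i, (q i : ℂ) • U i) : IsLCUFormulaOver E V W μ ‖V - W‖ := by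
  classical
  let e := (Fintype.equivFin {i // 0 < q i}).symm
  have hz : ∀ i, i ∉ Finset.univ.filter (fun i => 0 < q i) → q i = 0 := fun i hi => by
    simp only [Finset.mem_filter, Finset.mem_univ, true_and, not_lt] at hi
    exact le_antisymm hi (hq i)
  have hred : ∀ {M : Type} [AddCommMonoid M] (f : ι → M), (∀ i, q i = 0 → f i = 0) →
      ∑ k, f (e k) = ∑ i, f i := by
    intro M _ f hf
    rw [e.sum_comp (fun i => f i), ← Finset.sum_subset (Finset.subset_univ
      (Finset.univ.filter fun i => 0 < q i)) fun i _ hi => hf i (hz i hi)]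
    exact (Finset.sum_subtype _ (by simp) f).symm
  refine ⟨hμ, le_rfl, _, fun k => q (e k), fun k => U (e k), fun k => (e k).2, ?_,
    fun k => hU _, fun k => hE _, ?_⟩
  · rw [hred q fun i hi => hi, hsum]
  · rw [hW, hred (fun i => (q i : ℂ) • U i) fun i hi => by simp [hi]]

theorem exp_smul_mem_unitary {n : ℕ} {P : Op n} (hP : P.IsHermitian) (θ : ℝ) :
    NormedSpace.exp ((Complex.I * (θ : ℂ)) • P) ∈ unitary (Op n) := by
  have h1 := evolution_mem_unitary hP (-θ)
  simpa [evolution] using h1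

theorem signedPauli_isHermitian {n : ℕ} (C : Op n) (σ : Fin n → Fin 4) :
    (signedPauli C σ).IsHermitian := by
  unfold signedPauli
  split_ifs
  · exact pauliString_isHermitian σ
  · exact (pauliString_isHermitian σ).neg

/-- The compensation is a mixture of Pauli rotations. -/
theorem compensation_eq_rotationMixture {n L : ℕ} (K : ℕ) {h : Fin L → Op n}
    (hh : ∀ l, (h l).IsHermitian) {x : ℝ} (hη : etaSum pauliNorm K h x ≠ 0) :
    compensation K h x = (Real.sqrt (1 + etaSum pauliNorm K h x ^ 2) : ℂ) •
      ∑ s ∈ Finset.Icc (K + 1) (2 * K + 1),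
        ((pauliNorm (compCoeff K h (s - 1)) * (x ^ s / (s.factorial : ℝ)) /
            etaSum pauliNorm K h x : ℝ) : ℂ) •
          rotationMixture (compCoeff K h (s - 1)) (etaSum pauliNorm K h x) := by
  set η := etaSum pauliNorm K h x with hdef
  have h1 : ∀ s, (Real.sqrt (1 + η ^ 2) : ℂ) •
      ((pauliNorm (compCoeff K h (s - 1)) * (x ^ s / (s.factorial : ℝ)) / η : ℝ) : ℂ) •
        rotationMixture (compCoeff K h (s - 1)) η
      = ((pauliNorm (compCoeff K h (s - 1)) * (x ^ s / (s.factorial : ℝ)) / η : ℝ) : ℂ) •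
          (1 : Op n) + ((x ^ s / (s.factorial : ℝ) : ℝ) : ℂ) • compCoeff K h (s - 1) := by
    intro s
    have h2 := pauliNorm_smul_rotationMixture (compCoeff_conjTranspose K hh (s - 1)) η
    have h3 := congrArg (fun A => ((x ^ s / (s.factorial : ℝ) / η : ℝ) : ℂ) • A) h2
    simp only [smul_add, smul_smul, ← Complex.ofReal_mul, div_mul_cancel₀ _ hη] at h3
    have e1 : pauliNorm (compCoeff K h (s - 1)) * (x ^ s / (s.factorial : ℝ)) / η
        = x ^ s / (s.factorial : ℝ) / η * pauliNorm (compCoeff K h (s - 1)) := by ring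
    rw [smul_smul, ← Complex.ofReal_mul, e1, ← h3]
    congr 2
    ring
  rw [Finset.smul_sum, Finset.sum_congr rfl fun s _ => h1 s, Finset.sum_add_distrib,
    ← Finset.sum_smul, ← Complex.ofReal_sum, ← Finset.sum_div]
  -- The weights of the orders `s` sum to `1`, so their shares of the identity recombine to the
  -- leading term of the compensation.
  have h4 : (∑ s ∈ Finset.Icc (K + 1) (2 * K + 1),
      pauliNorm (compCoeff K h (s - 1)) * (x ^ s / (s.factorial : ℝ))) / η = 1 := div_self hη
  rw [h4, Complex.ofReal_one, one_smul, compensation]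

theorem compensation_eq_one_of_etaSum_eq_zero {n L : ℕ} {K : ℕ} {h : Fin L → Op n} {x : ℝ} (hx : 0 < x)
    (hη : etaSum pauliNorm K h x = 0) : compensation K h x = 1 := by
  rw [compensation, add_eq_left]
  refine Finset.sum_eq_zero fun s hs => ?_
  have h1 := (Finset.sum_eq_zero_iff_of_nonneg fun s _ =>
    mul_nonneg (pauliNorm_nonneg (compCoeff K h (s - 1))) (by positivity)).1 hη s hs
  rw [pauliNorm_eq_zero ((mul_eq_zero.1 h1).resolve_right (by positivity)), smul_zero]

theorem isLCUFormulaOver_pauliRotations {n L : ℕ} (K : ℕ) {h : Fin L → Op n}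
    (hh : ∀ l, (h l).IsHermitian) {x : ℝ} (hx : 0 < x) (V : Op n) :
    IsLCUFormulaOver (pauliRotations n (Real.arctan (etaSum pauliNorm K h x))) V
      (compensation K h x) (Real.sqrt (1 + etaSum pauliNorm K h x ^ 2))
      ‖V - compensation K h x‖ := by
  set η := etaSum pauliNorm K h x with hdef
  have hμ : 0 < Real.sqrt (1 + η ^ 2) := Real.sqrt_pos.2 (by positivity)
  rcases eq_or_ne η 0 with hη | hη
  · refine IsLCUFormulaOver.of_fintype hμ (fun _ : Unit => 1) (fun _ => 1) (by simp) (by simp)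
      (fun _ => one_mem _) (fun _ => ⟨fun _ => 0, 1, Or.inl rfl, by simp [hη]⟩) ?_
    rw [compensation_eq_one_of_etaSum_eq_zero hx (hdef ▸ hη), hη]
    simp
  · set N : ℕ → ℝ := fun s => pauliNorm (compCoeff K h (s - 1)) with hN
    have hN0 : ∀ s, 0 ≤ N s := fun s => pauliNorm_nonneg _
    have hη0 : 0 ≤ η := Finset.sum_nonneg fun s _ => mul_nonneg (hN0 s) (by positivity)
    refine IsLCUFormulaOver.of_fintype hμ
      (ι := Finset.Icc (K + 1) (2 * K + 1) × (Fin n → Fin 4))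
      (fun i => N i.1 * (x ^ (i.1 : ℕ) / ((i.1 : ℕ).factorial : ℝ)) / η
        * (‖pauliCoeff (compCoeff K h (i.1 - 1)) i.2‖ / N i.1))
      (fun i => NormedSpace.exp ((Complex.I * (Real.arctan η : ℂ)) •
        signedPauli (compCoeff K h (i.1 - 1)) i.2)) ?_ ?_ ?_ ?_ ?_
    · intro i
      have := hN0 i.1
      positivity
    · rw [Fintype.sum_prod_type]
      simp only [← Finset.mul_sum, ← Finset.sum_div]
      have h1 : ∀ s : Finset.Icc (K + 1) (2 * K + 1),
          N s * (x ^ (s : ℕ) / ((s : ℕ).factorial : ℝ)) / η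
            * ((∑ σ, ‖pauliCoeff (compCoeff K h (s - 1)) σ‖) / N s)
          = N s * (x ^ (s : ℕ) / ((s : ℕ).factorial : ℝ)) / η := by
        intro s
        change _ * (N s / N s) = _
        rcases eq_or_ne (N s) 0 with h0 | h0
        · simp [h0]
        · rw [div_self h0, mul_one]
      simp only [h1]
      rw [Finset.sum_coe_sort (Finset.Icc (K + 1) (2 * K + 1)) fun s =>
        N s * (x ^ s / (s.factorial : ℝ)) / η, ← Finset.sum_div]
      exact div_self hη
    · exact fun i => exp_smul_mem_unitary (signedPauli_isHermitian _ _) _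
    · intro i
      obtain ⟨ε, hε, hs, _⟩ := signedPauli_eq (compCoeff K h (i.1 - 1)) i.2
      exact ⟨i.2, ε, hε, by rw [hs]⟩
    · rw [compensation_eq_rotationMixture K hh hη, Fintype.sum_prod_type,
        ← Finset.sum_coe_sort (Finset.Icc (K + 1) (2 * K + 1))]
      congr 1
      refine Finset.sum_congr rfl fun s _ => ?_
      rw [rotationMixture, Finset.smul_sum]
      refine Finset.sum_congr rfl fun σ _ => ?_
      rw [smul_smul, ← Complex.ofReal_mul]

/-! ### The infimum norm and LCU formulas by diagonalization. -/

/-- Without this the infimum could be the default value `0` of an empty set. The formula is the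
Pauli expansion with phases absorbed into the unitaries; for `V = 0` it is the mean of `1` and `-1`.
-/
theorem exists_isLCUFormula {n : ℕ} (V : Op n) : ∃ μ, IsLCUFormula V V μ 0 := by
  rcases eq_or_ne (pauliNorm V) 0 with h0 | h0
  · refine ⟨1, ?_⟩
    have h1 := IsLCUFormulaOver.of_fintype (n := n) (E := Set.univ) (V := V) (W := V) one_pos
      (fun _ : Bool => 1 / 2) (fun b => if b then 1 else -1) (by simp) (by simp)
      (fun b => by
        cases b
        · exact Unitary.mem_iff.2 (by simp)
        · exact one_mem _)
      (fun _ => trivial) (by rw [pauliNorm_eq_zero h0]; simp)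
    rw [sub_self, norm_zero] at h1
    exact h1
  · refine ⟨pauliNorm V, ?_⟩
    have hpos : 0 < pauliNorm V := lt_of_le_of_ne (pauliNorm_nonneg V) h0.symm
    set ph : (Fin n → Fin 4) → ℂ := fun σ =>
      if pauliCoeff V σ = 0 then 1 else pauliCoeff V σ / (‖pauliCoeff V σ‖ : ℂ) with hph
    have hph1 : ∀ σ, ‖ph σ‖ = 1 := by
      intro σ
      simp only [hph]
      split_ifs with h
      · exact norm_one
      · rw [norm_div, Complex.norm_real, norm_norm, div_self (norm_ne_zero_iff.2 h)]
    have hph2 : ∀ σ, (‖pauliCoeff V σ‖ : ℂ) * ph σ = pauliCoeff V σ := by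
      intro σ
      simp only [hph]
      split_ifs with h
      · simp [h]
      · rw [mul_div_cancel₀]
        simpa using h
    have h1 := IsLCUFormulaOver.of_fintype (n := n) (E := Set.univ) (V := V) (W := V) hpos
      (fun σ => ‖pauliCoeff V σ‖ / pauliNorm V) (fun σ => ph σ • pauliString σ)
      (fun σ => by positivity) (by rw [← Finset.sum_div]; exact div_self h0)
      (fun σ => by
        have h2 : star (ph σ) * ph σ = 1 := by
          rw [Complex.star_def, Complex.conj_mul', hph1]
          simp
        have h3 := mul_comm (star (ph σ)) (ph σ)
        rw [Unitary.mem_iff, Matrix.star_eq_conjTranspose, Matrix.conjTranspose_smul,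
          (pauliString_isHermitian σ).eq, smul_mul_smul_comm, smul_mul_smul_comm, ← h3, h2,
          pauliString_mul_self, one_smul]
        exact ⟨rfl, rfl⟩)
      (fun _ => trivial) (by
        conv_lhs => rw [← sum_pauliCoeff_smul V]
        rw [Finset.smul_sum]
        refine Finset.sum_congr rfl fun σ _ => ?_
        rw [smul_smul, smul_smul, ← Complex.ofReal_mul, mul_div_cancel₀ _ h0, hph2])
    rw [sub_self, norm_zero] at h1
    exact h1

theorem norm_le_oneNorm {n : ℕ} (V : Op n) : ‖V‖ ≤ oneNorm V := by
  refine le_csInf (exists_isLCUFormula V) ?_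
  rintro μ ⟨hμ, _, Γ, p, U, hp, hsum, hU, _, hV⟩
  rw [hV, norm_smul, Complex.norm_real, Real.norm_of_nonneg hμ.le]
  refine mul_le_of_le_one_right hμ.le ((norm_sum_le _ _).trans ?_)
  rw [← hsum]
  refine Finset.sum_le_sum fun i _ => ?_
  rw [norm_smul, Complex.norm_real, Real.norm_of_nonneg (hp i).le,
    CStarRing.norm_of_mem_unitary (hU i), mul_one]

theorem oneNorm_nonneg {n : ℕ} (V : Op n) : 0 ≤ oneNorm V :=
  (norm_nonneg V).trans (norm_le_oneNorm V)

/-- A point of the unit disc is the midpoint of two points of the unit circle. -/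
theorem exists_norm_one_add_eq {z : ℂ} (hz : ‖z‖ ≤ 1) :
    ∃ w w' : ℂ, ‖w‖ = 1 ∧ ‖w'‖ = 1 ∧ w + w' = 2 * z := by
  rcases eq_or_ne z 0 with rfl | h0
  · exact ⟨1, -1, by simp, by simp, by simp⟩
  · have hn : (‖z‖ : ℂ) ≠ 0 := by simpa using h0
    have hu : ‖z / (‖z‖ : ℂ)‖ = 1 := by
      rw [norm_div, Complex.norm_real, norm_norm, div_self (norm_ne_zero_iff.2 h0)]
    have hy : ∀ ε : ℝ, ε ^ 2 = 1 →
        ‖(‖z‖ : ℂ) + ((ε * Real.sqrt (1 - ‖z‖ ^ 2) : ℝ) : ℂ) * Complex.I‖ = 1 := by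
      intro ε hε
      have h1 : 0 ≤ 1 - ‖z‖ ^ 2 := by nlinarith [norm_nonneg z]
      rw [Complex.norm_add_mul_I, mul_pow, hε, Real.sq_sqrt h1]
      simp
    refine ⟨z / (‖z‖ : ℂ) * ((‖z‖ : ℂ) + ((1 * Real.sqrt (1 - ‖z‖ ^ 2) : ℝ) : ℂ) * Complex.I),
      z / (‖z‖ : ℂ) * ((‖z‖ : ℂ) + ((-1 * Real.sqrt (1 - ‖z‖ ^ 2) : ℝ) : ℂ) * Complex.I),
      by rw [norm_mul, hu, hy 1 (by norm_num), one_mul],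
      by rw [norm_mul, hu, hy (-1) (by norm_num), one_mul], ?_⟩
    push_cast
    field_simp
    ring

theorem diagonal_mem_unitary {n : ℕ} {w : (Fin n → Fin 2) → ℂ} (hw : ∀ i, ‖w i‖ = 1) :
    Matrix.diagonal w ∈ unitary (Op n) := by
  have h1 : ∀ i, star (w i) * w i = 1 := fun i => by
    rw [Complex.star_def, Complex.conj_mul', hw]
    simp
  rw [Unitary.mem_iff, Matrix.star_eq_conjTranspose, Matrix.diagonal_conjTranspose,
    Matrix.diagonal_mul_diagonal, Matrix.diagonal_mul_diagonal, ← Matrix.diagonal_one]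
  refine ⟨congrArg _ (funext fun i => h1 i), congrArg _ (funext fun i => ?_)⟩
  rw [mul_comm]
  exact h1 i

/-- A normal operator with eigenvalues in the disc of radius `μ` has an LCU formula with
coefficient `μ`. -/
theorem isLCUFormula_of_diagonal {n : ℕ} {Q : Op n} (hQ : Q ∈ unitary (Op n))
    {z : (Fin n → Fin 2) → ℂ} {μ : ℝ} (hμ : 0 < μ) (hz : ∀ i, ‖z i‖ ≤ μ) (V : Op n) :
    IsLCUFormula V (Q * Matrix.diagonal z * star Q) μ ‖V - Q * Matrix.diagonal z * star Q‖ := by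
  have h1 : ∀ i, ∃ w w' : ℂ, ‖w‖ = 1 ∧ ‖w'‖ = 1 ∧ w + w' = 2 * (z i / μ) := fun i =>
    exists_norm_one_add_eq (by
      rw [norm_div, Complex.norm_real, Real.norm_of_nonneg hμ.le]
      exact (div_le_one hμ).2 (hz i))
  choose w w' hw hw' hww using h1
  have hmem : ∀ {v : (Fin n → Fin 2) → ℂ}, (∀ i, ‖v i‖ = 1) →
      Q * Matrix.diagonal v * star Q ∈ unitary (Op n) := fun hv =>
    mul_mem (mul_mem hQ (diagonal_mem_unitary hv)) (Unitary.star_mem hQ)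
  refine IsLCUFormulaOver.of_fintype hμ (fun _ : Bool => 1 / 2)
    (fun b => Q * Matrix.diagonal (if b then w else w') * star Q) (by simp) (by simp)
    (fun b => ?_) (fun _ => trivial) ?_
  · cases b
    · exact hmem hw'
    · exact hmem hw
  · have h2 : Matrix.diagonal z = (μ : ℂ) • ((1 / 2 : ℝ) : ℂ) •
        (Matrix.diagonal w + Matrix.diagonal w' : Op n) := by
      rw [Matrix.diagonal_add, ← Matrix.diagonal_smul, ← Matrix.diagonal_smul]
      refine congrArg _ (funext fun i => ?_)
      have hμ' : (μ : ℂ) ≠ 0 := by exact_mod_cast hμ.ne'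
      have := hww i
      simp only [Pi.smul_apply, smul_eq_mul, this]
      push_cast
      field_simp
    rw [Fintype.sum_bool, ← smul_add, h2, mul_smul_comm, mul_smul_comm, smul_mul_assoc,
      smul_mul_assoc, mul_add, add_mul]
    rfl

/-- The spectral theorem applies to the Hermitian operator `-i X`, and unitary invariance of the
norm bounds its eigenvalues. -/
theorem exists_diagonalization {n : ℕ} {X : Op n} (hX : Xᴴ = -X) :
    ∃ Q ∈ unitary (Op n), ∃ v : (Fin n → Fin 2) → ℝ, (∀ i, |v i| ≤ ‖X‖) ∧
      X = Q * Matrix.diagonal (fun i => Complex.I * (v i : ℂ)) * star Q := by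
  have hB : (-Complex.I • X).IsHermitian := by
    rw [Matrix.IsHermitian, Matrix.conjTranspose_smul, hX]
    simp
  set Q : Op n := hB.eigenvectorUnitary.1 with hQ
  have hQm : Q ∈ unitary (Op n) := hB.eigenvectorUnitary.2
  set v := hB.eigenvalues with hv
  have hspec : -Complex.I • X = Q * Matrix.diagonal (fun i => (v i : ℂ)) * star Q := by
    have := hB.spectral_theorem
    rwa [Unitary.conjStarAlgAut_apply] at this
  refine ⟨Q, hQm, v, fun i => ?_, ?_⟩
  · have h1 : ‖X‖ = ‖(Matrix.diagonal (fun i => (v i : ℂ)) : Op n)‖ := by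
      rw [← CStarRing.norm_mem_unitary_mul (Matrix.diagonal _) hQm,
        ← CStarRing.norm_mul_mem_unitary (Q * Matrix.diagonal _) (Unitary.star_mem hQm), ← hspec,
        norm_smul]
      simp
    rw [h1, Matrix.l2_opNorm_diagonal]
    simpa using norm_le_pi_norm (fun i => (v i : ℂ)) i
  · have h1 : (fun i => Complex.I * (v i : ℂ)) = Complex.I • fun i => (v i : ℂ) := rfl
    rw [h1, Matrix.diagonal_smul, mul_smul_comm, smul_mul_assoc, ← hspec, smul_smul]
    simp

theorem oneNorm_le_norm {n : ℕ} {X : Op n} (hX : Xᴴ = -X) : oneNorm X ≤ ‖X‖ := by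
  obtain ⟨Q, hQ, v, hv, hXQ⟩ := exists_diagonalization hX
  refine le_of_forall_pos_le_add fun ε hε => csInf_le ⟨0, fun μ hμ => hμ.1.le⟩ ?_
  -- The added `ε` keeps the coefficient of the formula positive even for `X = 0`.
  have h1 := isLCUFormula_of_diagonal hQ (z := fun i => Complex.I * (v i : ℂ))
    (μ := ‖X‖ + ε) (by positivity) (fun i => by
      rw [norm_mul, Complex.norm_I, one_mul, Complex.norm_real]
      exact (hv i).trans (by linarith)) X
  rw [← hXQ, sub_self, norm_zero] at h1
  exact h1

/-- The eigenvalues `1 + i v` have modulus `√(1 + v²) ≤ √(1 + η²)`: orthogonality of the real and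
imaginary parts gives the square root. -/
theorem isLCUFormula_one_add {n : ℕ} {X : Op n} (hX : Xᴴ = -X) {η : ℝ} (hη : ‖X‖ ≤ η) (V : Op n) :
    IsLCUFormula V (1 + X) (Real.sqrt (1 + η ^ 2)) ‖V - (1 + X)‖ := by
  obtain ⟨Q, hQ, v, hv, hXQ⟩ := exists_diagonalization hX
  have h1 := isLCUFormula_of_diagonal hQ (z := fun i => 1 + Complex.I * (v i : ℂ))
    (μ := Real.sqrt (1 + η ^ 2)) (Real.sqrt_pos.2 (by positivity)) (fun i => by
      have h2 : ‖(1 : ℂ) + Complex.I * (v i : ℂ)‖ = Real.sqrt (1 + v i ^ 2) := by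
        have := Complex.norm_add_mul_I 1 (v i)
        rw [mul_comm Complex.I]
        simpa using this
      rw [h2]
      refine Real.sqrt_le_sqrt (add_le_add le_rfl ?_)
      rw [← sq_abs]
      exact pow_le_pow_left₀ (abs_nonneg _) ((hv i).trans hη) 2) V
  have h3 : Q * Matrix.diagonal (fun i => 1 + Complex.I * (v i : ℂ)) * star Q = 1 + X := by
    have h4 : (Matrix.diagonal fun i => 1 + Complex.I * (v i : ℂ) : Op n)
        = 1 + Matrix.diagonal fun i => Complex.I * (v i : ℂ) := by
      rw [← Matrix.diagonal_one, Matrix.diagonal_add]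
    rw [h4, mul_add, add_mul, ← hXQ, mul_one, (Unitary.mem_iff.1 hQ).2]
  rwa [h3] at h1

theorem isLCUFormula_compensation {n L : ℕ} (K : ℕ) {h : Fin L → Op n}
    (hh : ∀ l, (h l).IsHermitian) {x : ℝ} (hx : 0 ≤ x) (V : Op n) :
    IsLCUFormula V (compensation K h x) (Real.sqrt (1 + etaSum oneNorm K h x ^ 2))
      ‖V - compensation K h x‖ := by
  refine isLCUFormula_one_add ?_ ?_ V
  · simp only [Matrix.conjTranspose_sum, Matrix.conjTranspose_smul, compCoeff_conjTranspose K hh,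
      smul_neg, Finset.sum_neg_distrib, Complex.star_def, Complex.conj_ofReal]
  · refine (norm_sum_le _ _).trans (Finset.sum_le_sum fun s _ => ?_)
    have h0 : 0 ≤ x ^ s / (s.factorial : ℝ) := by positivity
    rw [norm_smul, Complex.norm_real, Real.norm_of_nonneg h0, mul_comm]
    exact mul_le_mul_of_nonneg_right (norm_le_oneNorm _) h0

theorem alphaH_mono {n L : ℕ} {ν ν' : Op n → ℝ} (hν : ∀ A, ν A ≤ ν' A) (K : ℕ) (h : Fin L → Op n)
    (s : ℕ) : alphaH ν K h s ≤ alphaH ν' K h s :=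
  Finset.sum_le_sum fun _ _ => Finset.sum_le_sum fun _ _ =>
    mul_le_mul_of_nonneg_left (hν _) (Nat.cast_nonneg _)

/-- On the anti-Hermitian `C_s` the infimum norm is at most the spectral norm, for which the
commutator bound is known. Each spectral norm in that bound is in turn at most the infimum norm, so
no triangle inequality for `oneNorm` is needed. -/
theorem oneNorm_compCoeff_le {n L K : ℕ} (hK : K = 1 ∨ (Even K ∧ 0 < K)) {h : Fin L → Op n}
    (hh : ∀ l, (h l).IsHermitian) (s : ℕ) :
    oneNorm (compCoeff K h s) ≤ 2 * (stageCount K : ℝ) * alphaH oneNorm K h s := by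
  refine (oneNorm_le_norm (compCoeff_conjTranspose K hh s)).trans ?_
  refine (seminorm_compCoeff_le (normSeminorm ℂ (Op n)) K h s).trans
    ((compNorm_le hK (normSeminorm ℂ (Op n)) h s).trans ?_)
  exact mul_le_mul_of_nonneg_left (alphaH_mono norm_le_oneNorm K h s) (by positivity)

end TrotterLCU

end

open TrotterLCU
theorem mainTheorem4 {n L K : ℕ} (hK : K = 1 ∨ (Even K ∧ 0 < K))
    (h : Fin L → Op n) (hh : ∀ l, (h l).IsHermitian) {x : ℝ} (hx : 0 < x) :
    -- the nested-commutator coefficients are the Taylor coefficients of `J_K`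
    (∀ s, compCoeff K h s = iteratedDeriv s (derivRemainder K h) 0) ∧
    -- LCU formula over arbitrary unitaries, and the bound on its 1-norm
    IsLCUFormula (trotterRemainder K h x) (compensation K h x)
      (Real.sqrt (1 + etaSum oneNorm K h x ^ 2))
      ‖trotterRemainder K h x - compensation K h x‖ ∧
    Real.sqrt (1 + etaSum oneNorm K h x ^ 2) ≤
      Real.sqrt (1 + 4 * (stageCount K : ℝ) ^ 2 *
        (∑ s ∈ Finset.Icc K (2 * K),
          alphaH oneNorm K h s * (x ^ (s + 1) / ((s + 1).factorial : ℝ))) ^ 2) ∧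
    -- LCU formula over Pauli rotations, in explicit paired form, and the bound on its 1-norm
    IsLCUFormulaOver (pauliRotations n (Real.arctan (etaSum pauliNorm K h x)))
      (trotterRemainder K h x) (compensation K h x)
      (Real.sqrt (1 + etaSum pauliNorm K h x ^ 2))
      ‖trotterRemainder K h x - compensation K h x‖ ∧
    (etaSum pauliNorm K h x ≠ 0 →
      compensation K h x =
        (Real.sqrt (1 + etaSum pauliNorm K h x ^ 2) : ℂ) •
          ∑ s ∈ Finset.Icc (K + 1) (2 * K + 1),
            ((pauliNorm (compCoeff K h (s - 1)) * (x ^ s / (s.factorial : ℝ)) /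
                etaSum pauliNorm K h x : ℝ) : ℂ) •
              rotationMixture (compCoeff K h (s - 1)) (etaSum pauliNorm K h x)) ∧
    Real.sqrt (1 + etaSum pauliNorm K h x ^ 2) ≤
      Real.sqrt (1 + 4 * (stageCount K : ℝ) ^ 2 *
        (∑ s ∈ Finset.Icc K (2 * K),
          alphaH pauliNorm K h s * (x ^ (s + 1) / ((s + 1).factorial : ℝ))) ^ 2) ∧
    -- the error bound
    ‖trotterRemainder K h x - compensation K h x‖ ≤
      4 * (stageCount K : ℝ) ^ 2 * alphaH (fun A => ‖A‖) K h K *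
          (∑ s ∈ Finset.Icc K (2 * K),
            alphaH (fun A => ‖A‖) K h s *
              (x ^ (s + K + 2) /
                ((s.factorial : ℝ) * ((K + 1).factorial : ℝ) * ((s + K + 2 : ℕ) : ℝ)))) +
        2 * (stageCount K : ℝ) * (x ^ (2 * K + 2) / ((2 * K + 2).factorial : ℝ)) *
          alphaH (fun A => ‖A‖) K h (2 * K + 1) := by
  have hx0 := hx.le
  exact ⟨fun s => compCoeff_eq_iteratedDeriv K hh s,
    isLCUFormula_compensation K hh hx0 _,
    sqrt_one_add_etaSum_sq_le K h oneNorm_nonneg (oneNorm_compCoeff_le hK hh) hx0,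
    isLCUFormulaOver_pauliRotations K hh hx _,
    fun hη => compensation_eq_rotationMixture K hh hη,
    sqrt_one_add_etaSum_sq_le K h pauliNorm_nonneg
      (fun s => (seminorm_compCoeff_le (pauliSeminorm n) K h s).trans
        (compNorm_le hK (pauliSeminorm n) h s)) hx0,
    norm_trotterRemainder_sub_compensation_le_alphaH hK hh hx0⟩
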